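/- Let $1\le s\le n$ and let $x\in\mathbb{R}^n$ satisfy $\|x\|_2=1$ and have exactly $s$ non-zero entries; let $f=\|\cdot\|_1$ and $g\sim\mathcal N(0,I_n)$. Put $Q_x=I_n+(\sqrt{\pi/2}-1)xx^\top$, let $\mathcal T_f(x)=\{u: f(x+tu)\le f(x)\text{ for some }t>0\}$ be the descent cone and $\partial f(x)$ the subdifferential of $f$ at $x$, and define the threshold and its surrogate $$\zeta_{\rm PO}(x;f)=\Big[\mathbb E\sup_{u\in\mathcal T_f(x),\ \|Q_xu\|_2=1}\big\langle (I_n-xx^\top)g,u\big\rangle\Big]^2,\qquad \hat\zeta_{\rm PO}(x;f)=\inf_{\tau\ge0}\mathbb E\big[\operatorname{dist}^2(g,\tau\, Q_x^{-1}\partial f(x))\big].$$ For $u,v\in(0,1]$ let $$\psi(u,v)=\inf_{\tau\ge0}\Big\{u\Big(1+\tau^2-\tau^2v\big(1-\tfrac2\pi\big)\Big)+(1-u)\sqrt{\tfrac2\pi}\int_\tau^\infty(w-\tau)^2e^{-w^2/2}\,dw\Big\}.$$ Then, with $\psi_x:=\psi\big(\tfrac sn,\tfrac{\|x\|_1^2}{s}\big)$,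 $$\hat\zeta_{\rm PO}(x;\|\cdot\|_1)=n\psi_x,$$ $$n\psi_x-\Big(\frac{8n\psi_x}{\pi}\Big)^{1/2}-\frac{\sqrt{2\pi n}}{\|x\|_1}-\Big(1-\frac2\pi\Big)\ \le\ \zeta_{\rm PO}(x;\|\cdot\|_1)\ \le\ n\psi_x.$$ Moreover, among unit vectors of $\mathbb R^n$ with exactly $s$ non-zero entries, the surrogate $\hat\zeta_{\rm PO}(x;\|\cdot\|_1)=n\psi_x$ is a non-increasing function of $\|x\|_1$, strictly decreasing if $s<n$; it is smallest at the equal-amplitude signals (all non-zero entries of the same modulus), and if $s<n$ only at these. -/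

import Mathlib

open MeasureTheory ProbabilityTheory Set
open scoped NNReal RealInnerProductSpace Pointwise

namespace PhaseOnly

noncomputable section

/-- The signal space `ℝⁿ` with the Euclidean norm `‖·‖₂`. -/
abbrev Sig (n : ℕ) : Type := EuclideanSpace ℝ (Fin n)

/-- The `ℓ₁` norm `‖x‖₁`. -/
def l1 {n : ℕ} (x : Sig n) : ℝ := ∑ i, |x i|

/-- The number of non-zero entries of `x`. -/
def nnzEntries {n : ℕ} (x : Sig n) : ℕ := (Finset.univ.filter fun i => x i ≠ 0).card

/-- All non-zero entries of `x` have the same modulus. -/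
def EqualAmplitude {n : ℕ} (x : Sig n) : Prop :=
  ∀ i j, x i ≠ 0 → x j ≠ 0 → |x i| = |x j|

/-- The descent cone `{u : f (x + t u) ≤ f x for some t > 0}` of `f` at `x`. -/
def descentCone {n : ℕ} (f : Sig n → ℝ) (x : Sig n) : Set (Sig n) :=
  {u | ∃ t : ℝ, 0 < t ∧ f (x + t • u) ≤ f x}

/-- The subdifferential `∂f(x)`. -/
def subdiff {n : ℕ} (f : Sig n → ℝ) (x : Sig n) : Set (Sig n) :=
  {u | ∀ y, f x + ⟪u, y - x⟫ ≤ f y}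

/-- The matrix `Q_x = I + (√(π/2) - 1) x xᵀ`, as a linear map. -/
def Q {n : ℕ} (x : Sig n) : Sig n →ₗ[ℝ] Sig n where
  toFun u := u + ((√(Real.pi / 2) - 1) * ⟪x, u⟫) • x
  map_add' u v := by
    rw [inner_add_right]
    module
  map_smul' c u := by
    rw [inner_smul_right]
    simp only [RingHom.id_apply]
    module

/-- The orthogonal projection `I - x xᵀ` (for a unit vector `x`). -/
def projPerp {n : ℕ} (x g : Sig n) : Sig n := g - ⟪x, g⟫ • x

/-- The random variable `sup { ⟪(I - x xᵀ) g, u⟫ : u ∈ T_f(x), ‖Q_x u‖ = 1 }` as a function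
of `g`. -/
def coneSup {n : ℕ} (f : Sig n → ℝ) (x g : Sig n) : ℝ :=
  sSup ((fun u => ⟪projPerp x g, u⟫) '' {u | u ∈ descentCone f x ∧ ‖Q x u‖ = 1})

/-- The phase transition threshold `ζ_PO(x; f)`: the square of the expectation of `coneSup`
under `g ∼ N(0, I_n)`. -/
def zetaPO {n : ℕ} (x : Sig n) (f : Sig n → ℝ) : ℝ :=
  (∫ g, coneSup f x g ∂(stdGaussian (Sig n))) ^ 2

/-- The surrogate threshold `inf_{τ ≥ 0} E dist²(g, τ · Q_x⁻¹ ∂f(x))`. Since `Q_x` is invertible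
for a unit vector `x`, the set `Q_x⁻¹ ∂f(x)` is the preimage of `∂f(x)` under `Q_x`. -/
def zetaHatPO {n : ℕ} (x : Sig n) (f : Sig n → ℝ) : ℝ :=
  ⨅ τ : ℝ≥0, ∫ g, (Metric.infDist g ((τ : ℝ) • (Q x ⁻¹' subdiff f x))) ^ 2
    ∂(stdGaussian (Sig n))

/-- The function `ψ(u, v)`. -/
def psi (u v : ℝ) : ℝ :=
  ⨅ τ : ℝ≥0,
    (u * (1 + (τ : ℝ) ^ 2 - (τ : ℝ) ^ 2 * v * (1 - 2 / Real.pi))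
      + (1 - u) * √(2 / Real.pi)
        * ∫ w in Ioi (τ : ℝ), (w - τ) ^ 2 * Real.exp (-(w ^ 2) / 2))

/-! Well-definedness: the suprema are finite, the expectations exist, `Q_x` is invertible. -/

lemma Q_apply {n : ℕ} (x u : Sig n) :
    Q x u = u + ((√(Real.pi / 2) - 1) * ⟪x, u⟫) • x := rfl

/-- For a unit vector `x`, the inverse of `Q_x` is `I - (1 - √(2/π)) x xᵀ`. -/
lemma preimage_Q {n : ℕ} (x : Sig n) (hx : ‖x‖ = 1) (S : Set (Sig n)) :
    Q x ⁻¹' S = (fun w => w - ((1 - √(2 / Real.pi)) * ⟪x, w⟫) • x) '' S := by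
  have hxx : ⟪x, x⟫ = 1 := by rw [real_inner_self_eq_norm_sq, hx]; norm_num
  have hab : √(Real.pi / 2) * √(2 / Real.pi) = 1 := by
    rw [← Real.sqrt_mul (by positivity)]
    rw [show Real.pi / 2 * (2 / Real.pi) = 1 by field_simp]
    exact Real.sqrt_one
  ext u
  simp only [mem_preimage, mem_image]
  constructor
  · intro h
    refine ⟨_, h, ?_⟩
    rw [Q_apply, inner_add_right, inner_smul_right, hxx, add_sub_assoc, ← sub_smul,
      add_eq_left]
    convert zero_smul ℝ x using 2
    linear_combination ⟪x, u⟫ * hab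
  · rintro ⟨w, hw, rfl⟩
    convert hw using 1
    rw [Q_apply, inner_sub_right, inner_smul_right, hxx, sub_add, ← sub_smul, eq_comm,
      sub_eq_self.2]
    convert zero_smul ℝ x using 2
    linear_combination -⟪x, w⟫ * hab

lemma norm_le_norm_Q {n : ℕ} (x u : Sig n) : ‖u‖ ≤ ‖Q x u‖ := by
  have ha : 1 ≤ √(Real.pi / 2) := by
    rw [Real.one_le_sqrt]; linarith [Real.two_le_pi]
  apply le_of_sq_le_sq _ (norm_nonneg _)
  rw [Q_apply, norm_add_sq_real, inner_smul_right, real_inner_comm x u]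
  have h2 : 0 ≤ (√(Real.pi / 2) - 1) * ⟪x, u⟫ * ⟪x, u⟫ := by
    rw [mul_assoc]; exact mul_nonneg (by linarith) (mul_self_nonneg _)
  nlinarith [sq_nonneg ‖((√(Real.pi / 2) - 1) * ⟪x, u⟫) • x‖]

lemma projPerp_sub {n : ℕ} (x g h : Sig n) :
    projPerp x g - projPerp x h = projPerp x (g - h) := by
  simp only [projPerp, inner_sub_right]; module

lemma norm_projPerp_le {n : ℕ} (x : Sig n) (hx : ‖x‖ = 1) (g : Sig n) :
    ‖projPerp x g‖ ≤ ‖g‖ := by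
  apply le_of_sq_le_sq _ (norm_nonneg _)
  rw [projPerp, norm_sub_sq_real, norm_smul, hx, inner_smul_right, real_inner_comm x g,
    Real.norm_eq_abs, mul_one, sq_abs]
  nlinarith [sq_nonneg ⟪x, g⟫]

lemma bddAbove_coneSup {n : ℕ} (f : Sig n → ℝ) (x : Sig n) (hx : ‖x‖ = 1) (g : Sig n) :
    BddAbove ((fun u => ⟪projPerp x g, u⟫) '' {u | u ∈ descentCone f x ∧ ‖Q x u‖ = 1}) := by
  refine ⟨‖g‖, ?_⟩
  rintro _ ⟨u, ⟨-, hu⟩, rfl⟩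
  calc ⟪projPerp x g, u⟫ ≤ ‖projPerp x g‖ * ‖u‖ := real_inner_le_norm _ _
    _ ≤ ‖g‖ * 1 := mul_le_mul (norm_projPerp_le x hx g) (hu ▸ norm_le_norm_Q x u)
        (norm_nonneg _) (norm_nonneg _)
    _ = ‖g‖ := mul_one _

lemma lipschitz_coneSup {n : ℕ} (f : Sig n → ℝ) (x : Sig n) (hx : ‖x‖ = 1) :
    LipschitzWith 1 (coneSup f x) := by
  apply LipschitzWith.of_le_add
  intro g h
  rcases Set.eq_empty_or_nonempty {u | u ∈ descentCone f x ∧ ‖Q x u‖ = 1} with he | hne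
  · simp [coneSup, he, dist_nonneg]
  · apply csSup_le (hne.image _)
    rintro _ ⟨u, hu, rfl⟩
    have h1 : ⟪projPerp x h, u⟫ ≤ coneSup f x h :=
      le_csSup (bddAbove_coneSup f x hx h) ⟨u, hu, rfl⟩
    have h2 : ⟪projPerp x (g - h), u⟫ ≤ dist g h := by
      rw [dist_eq_norm]
      calc ⟪projPerp x (g - h), u⟫ ≤ ‖projPerp x (g - h)‖ * ‖u‖ := real_inner_le_norm _ _
        _ ≤ ‖g - h‖ * 1 := mul_le_mul (norm_projPerp_le x hx _)
            (hu.2 ▸ norm_le_norm_Q x u) (norm_nonneg _) (norm_nonneg _)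
        _ = ‖g - h‖ := mul_one _
    rw [← projPerp_sub, inner_sub_left] at h2
    show ⟪projPerp x g, u⟫ ≤ _
    linarith

lemma integrable_coneSup {n : ℕ} (f : Sig n → ℝ) (x : Sig n) (hx : ‖x‖ = 1) :
    Integrable (coneSup f x) (stdGaussian (Sig n)) := by
  have hL := lipschitz_coneSup f x hx
  have hid : Integrable (fun g : Sig n => ‖g‖ + |coneSup f x 0|) (stdGaussian (Sig n)) :=
    (IsGaussian.integrable_id (μ := stdGaussian (Sig n))).norm.add (integrable_const _)
  refine hid.mono' hL.continuous.aestronglyMeasurable (Filter.Eventually.of_forall fun g => ?_)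
  have h := hL.dist_le_mul g 0
  rw [Real.dist_eq, dist_zero_right, NNReal.coe_one, one_mul] at h
  rw [Real.norm_eq_abs]
  have := abs_sub_abs_le_abs_sub (coneSup f x g) (coneSup f x 0)
  linarith

lemma integrable_infDist_sq {n : ℕ} (S : Set (Sig n)) :
    Integrable (fun g => (Metric.infDist g S) ^ 2) (stdGaussian (Sig n)) := by
  have hL : LipschitzWith 1 (fun g : Sig n => Metric.infDist g S) :=
    Metric.lipschitz_infDist_pt S
  have hid : MemLp (fun g : Sig n => ‖g‖ + Metric.infDist 0 S) 2 (stdGaussian (Sig n)) :=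
    (IsGaussian.memLp_two_id (μ := stdGaussian (Sig n))).norm.add (memLp_const _)
  refine (hid.mono hL.continuous.aestronglyMeasurable
    (Filter.Eventually.of_forall fun g => ?_)).integrable_sq
  have h := Metric.infDist_le_infDist_add_dist (s := S) (x := g) (y := 0)
  rw [dist_zero_right] at h
  rw [Real.norm_of_nonneg Metric.infDist_nonneg, Real.norm_of_nonneg
    (add_nonneg (norm_nonneg _) Metric.infDist_nonneg)]
  linarith

end

end PhaseOnly

/-!
Write `L = ‖x‖₁`. Every subgradient `w ∈ ∂‖·‖₁(x)` satisfies `⟪x, w⟫ = L`, so `Q_x⁻¹ ∂‖·‖₁(x)` is the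
set of vectors with the prescribed entries `dualEntry x i` on the support of `x` and arbitrary
entries in `[-1, 1]` off it. The squared distance of `g` to `τ` times this set is therefore an
explicit sum (`distSq`), whose Gaussian mean `meanDistSq` is `n` times the function minimised in `ψ`.
This gives the formula for the surrogate. The mean is convex in `τ`, and it depends on `L` only
through the term `-τ² L² (1 - 2/π)`. It is thus decreasing in `L`; when `s < n` its slope at `τ = 0`
is negative, so that the optimal `τ` is positive and the decrease is strict. The equal-amplitude
signals are those with equality in the Cauchy–Schwarz inequality `L² ≤ s`.

Upper bound for the threshold (`zetaPO_le`): for a descent direction `u` with `‖Q_x u‖ = 1`, the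
polarity of descent directions and subgradients bounds `⟪g, Q_x u⟫` by the distance of `g` to each
dilate. The projection `I - x xᵀ` is the mean of the identity and a reflection, which preserves
the Gaussian measure, and Jensen's inequality concludes.

Lower bound (`le_zetaPO`): let `D(g)` be the distance of `g` to the dual cone, that is, the cone generated by
`Q_x⁻¹ ∂‖·‖₁(x)`, and `W(g)` the supremum of `⟪g, Q_x u⟫` over the descent directions above (`fullSup`).
The lower bound is a chain of three estimates.
* `E D² ≥ n ψ - √(2πn) / L` (`le_integral_distSq_level`). The dilation level `T(g)` at which the distance
  of `g` to the cone is attained is `√(π/2) / L`-Lipschitz in `g`, and the slope of half the squared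
  distance in `τ` is `√n`-Lipschitz in `g`. By convexity in `τ` the loss is at most twice the absolute
  covariance of the two.
* `D² ≤ W²`, because the residual of the projection onto the cone is, after normalization and up to
  `Q_x`, a descent direction; and `E W² ≤ (E W)² + 1`, because `W` is 1-Lipschitz.
* Restoring the projection `I - x xᵀ` costs at most `E|⟪x, g⟫| = √(2/π)`.

The covariance and the variance are controlled by the Gaussian Poincaré inequality with its sharp
constant: a `K`-Lipschitz function of a standard Gaussian vector has variance at most `K²`
(`variance_stdGaussian_le`). On the line it follows from the Cauchy–Schwarz inequality on the
increments `h X - h Y` and Tonelli's theorem, and it extends to several variables by the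
Efron–Stein inequality and Rademacher's theorem.
-/

namespace PhaseOnly

/-! ### One-dimensional Gaussian integrals -/

lemma gaussianPDFReal_zero_one (x : ℝ) :
    gaussianPDFReal 0 1 x = (√(2 * Real.pi))⁻¹ * Real.exp (-(x ^ 2) / 2) := by
  simp [gaussianPDFReal]

lemma hasDerivAt_gaussianPDFReal (x : ℝ) :
    HasDerivAt (gaussianPDFReal 0 1) (-(x * gaussianPDFReal 0 1 x)) x := by
  have h : HasDerivAt (fun x : ℝ => (√(2 * Real.pi))⁻¹ * Real.exp (-(x ^ 2) / 2))
      ((√(2 * Real.pi))⁻¹ * (Real.exp (-(x ^ 2) / 2) * (-(2 * x) / 2))) x := by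
    refine HasDerivAt.const_mul _ (HasDerivAt.exp ?_)
    simpa using ((hasDerivAt_pow 2 x).neg.div_const 2)
  rw [show gaussianPDFReal 0 1 = _ from funext gaussianPDFReal_zero_one]
  convert! h using 1
  ring

lemma integrable_mul_gaussianPDFReal :
    Integrable (fun x : ℝ => x * gaussianPDFReal 0 1 x) := by
  have h := (integrable_mul_exp_neg_mul_sq (b := 1 / 2) (by norm_num)).const_mul
    (√(2 * Real.pi))⁻¹
  refine h.congr (Filter.Eventually.of_forall fun x => ?_)
  simp only [gaussianPDFReal_zero_one]
  rw [show -(1 / 2) * x ^ 2 = -(x ^ 2) / 2 by ring]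
  ring

lemma tendsto_gaussianPDFReal_atTop :
    Filter.Tendsto (gaussianPDFReal 0 1) Filter.atTop (nhds 0) := by
  rw [show gaussianPDFReal 0 1 = _ from funext gaussianPDFReal_zero_one]
  rw [← mul_zero (√(2 * Real.pi))⁻¹]
  refine Filter.Tendsto.const_mul _ (Real.tendsto_exp_atBot.comp ?_)
  have h : Filter.Tendsto (fun x : ℝ => x ^ 2 / 2) Filter.atTop Filter.atTop :=
    (Filter.tendsto_pow_atTop two_ne_zero).atTop_div_const (by norm_num)
  refine (Filter.tendsto_neg_atTop_atBot.comp h).congr fun x => ?_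
  simp [neg_div]

lemma integral_Ioi_id_gaussianReal (s : ℝ) :
    ∫ x, (Ioi s).indicator id x ∂(gaussianReal 0 1) = gaussianPDFReal 0 1 s := by
  rw [integral_gaussianReal_eq_integral_smul one_ne_zero]
  have h := integral_Ioi_of_hasDerivAt_of_tendsto' (a := s)
    (fun x _ => (hasDerivAt_gaussianPDFReal x).neg)
    (by simpa using integrable_mul_gaussianPDFReal.integrableOn)
    tendsto_gaussianPDFReal_atTop.neg
  simp only [neg_neg, Pi.neg_apply, neg_zero, zero_sub] at h
  rw [← h, ← integral_indicator measurableSet_Ioi]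
  refine integral_congr_ae (Filter.Eventually.of_forall fun x => ?_)
  by_cases hx : x ∈ Ioi s <;> simp [hx, mul_comm]

lemma integrable_id_gaussianReal : Integrable (fun x : ℝ => x) (gaussianReal 0 1) :=
  (memLp_id_gaussianReal 1).integrable (by simp)

lemma integral_Iic_id_gaussianReal (s : ℝ) :
    ∫ x, (Iic s).indicator id x ∂(gaussianReal 0 1) = -gaussianPDFReal 0 1 s := by
  have h := integral_add (μ := gaussianReal 0 1)
    (integrable_id_gaussianReal.indicator (measurableSet_Iic (a := s)))
    (integrable_id_gaussianReal.indicator (measurableSet_Ioi (a := s)))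
  have h2 : ∀ x : ℝ, (Iic s).indicator (fun x => x) x + (Ioi s).indicator (fun x => x) x = x := by
    intro x
    rcases le_or_gt x s with hx | hx
    · simp [hx, not_lt.2 hx]
    · simp [hx, not_le.2 hx]
  simp only [h2, integral_id_gaussianReal] at h
  have h3 := integral_Ioi_id_gaussianReal s
  have h4 : (id : ℝ → ℝ) = fun x => x := rfl
  rw [h4] at h3 ⊢
  linarith

/-! ### The Gaussian Poincaré inequality on the line -/

/-- The Cauchy–Schwarz bound for an increment of a Lipschitz function in terms of its
derivative. -/
lemma sq_sub_le_mul_integral_deriv_sq {h : ℝ → ℝ} {K : ℝ≥0} (hh : LipschitzWith K h)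
    {x y : ℝ} (hxy : y ≤ x) :
    (h x - h y) ^ 2 ≤ (x - y) * ∫ s in y..x, deriv h s ^ 2 := by
  have hd : ∀ s, ‖deriv h s‖ ≤ K := fun s => norm_deriv_le_of_lipschitz hh
  have hm : Measurable (deriv h) := measurable_deriv h
  have hi1 : IntervalIntegrable (deriv h) volume y x :=
    (intervalIntegrable_const (c := (K : ℝ))).mono_fun hm.aestronglyMeasurable
      (Filter.Eventually.of_forall fun s => by simpa using hd s)
  have hi2 : IntervalIntegrable (fun s => deriv h s ^ 2) volume y x :=
    (intervalIntegrable_const (c := (K : ℝ) ^ 2)).mono_fun (hm.pow_const 2).aestronglyMeasurable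
      (Filter.Eventually.of_forall fun s => by
        have := pow_le_pow_left₀ (norm_nonneg _) (hd s) 2
        simpa using this)
  have hftc : ∫ s in y..x, deriv h s = h x - h y :=
    (hh.lipschitzOnWith.absolutelyContinuousOnInterval).integral_deriv_eq_sub
  rcases hxy.eq_or_lt with rfl | hlt
  · simp
  set c := (h x - h y) / (x - y) with hc
  have hpos : 0 ≤ ∫ s in y..x, (deriv h s - c) ^ 2 :=
    intervalIntegral.integral_nonneg hxy fun s _ => sq_nonneg _
  have hexp : ∫ s in y..x, (deriv h s - c) ^ 2
      = (∫ s in y..x, deriv h s ^ 2) - 2 * c * (h x - h y) + c ^ 2 * (x - y) := by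
    rw [← hftc, ← intervalIntegral.integral_const_mul, ← intervalIntegral.integral_sub hi2
      (hi1.const_mul _)]
    have : c ^ 2 * (x - y) = ∫ s in y..x, c ^ 2 := by
      rw [intervalIntegral.integral_const, smul_eq_mul, mul_comm]
    rw [this, ← intervalIntegral.integral_add (hi2.sub (hi1.const_mul _))
      intervalIntegrable_const]
    congr 1
    ext s
    ring
  have hxy' : 0 < x - y := sub_pos.2 hlt
  have hcx : c * (x - y) = h x - h y := by rw [hc]; field_simp
  rw [hexp] at hpos
  nlinarith [mul_nonneg hxy'.le hpos]

/-- The kernel that cuts `x - y` off to `y ≤ s < x`, as a function of `((x, y), s)`. -/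
noncomputable def gapKernel (p : ℝ × ℝ) (s : ℝ) : ENNReal :=
  (Ico p.2 p.1).indicator (fun _ => ENNReal.ofReal (p.1 - p.2)) s

lemma measurable_gapKernel : Measurable (Function.uncurry gapKernel) := by
  have hs : MeasurableSet {q : (ℝ × ℝ) × ℝ | q.1.2 ≤ q.2 ∧ q.2 < q.1.1} :=
    (measurableSet_le (f := fun q : (ℝ × ℝ) × ℝ => q.1.2) (g := fun q => q.2)
      (by fun_prop) (by fun_prop)).inter
      (measurableSet_lt (f := fun q : (ℝ × ℝ) × ℝ => q.2) (g := fun q => q.1.1)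
        (by fun_prop) (by fun_prop))
  have hf : Measurable (fun q : (ℝ × ℝ) × ℝ => ENNReal.ofReal (q.1.1 - q.1.2)) := by fun_prop
  exact hf.indicator hs

/-- The coefficient of `h'(s)²` in the Gaussian Poincaré inequality: for independent standard
normal `X`, `Y`, the mean of `X - Y` on the event `Y ≤ s < X` is the Gaussian density at `s`. -/
lemma lintegral_gapKernel (s : ℝ) :
    ∫⁻ p, gapKernel p s ∂((gaussianReal 0 1).prod (gaussianReal 0 1))
      = ENNReal.ofReal (gaussianPDFReal 0 1 s) := by
  have e : ∀ p : ℝ × ℝ, gapKernel p s = ENNReal.ofReal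
      ((Ioi s).indicator id p.1 * (Iic s).indicator 1 p.2
        - (Ioi s).indicator 1 p.1 * (Iic s).indicator id p.2) := by
    rintro ⟨x, y⟩
    by_cases hx : s < x <;> by_cases hy : y ≤ s <;> simp [gapKernel, hx, hy]
  have i1 : Integrable (fun x : ℝ => (Ioi s).indicator id x) (gaussianReal 0 1) :=
    integrable_id_gaussianReal.indicator measurableSet_Ioi
  have i2 : Integrable (fun x : ℝ => (Iic s).indicator id x) (gaussianReal 0 1) :=
    integrable_id_gaussianReal.indicator measurableSet_Iic
  have i3 : Integrable (fun x : ℝ => (Ioi s).indicator (1 : ℝ → ℝ) x) (gaussianReal 0 1) :=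
    (integrable_const (1 : ℝ)).indicator measurableSet_Ioi
  have i4 : Integrable (fun x : ℝ => (Iic s).indicator (1 : ℝ → ℝ) x) (gaussianReal 0 1) :=
    (integrable_const (1 : ℝ)).indicator measurableSet_Iic
  have i5 : Integrable (fun p : ℝ × ℝ => (Ioi s).indicator id p.1 * (Iic s).indicator 1 p.2
        - (Ioi s).indicator 1 p.1 * (Iic s).indicator id p.2)
      ((gaussianReal 0 1).prod (gaussianReal 0 1)) := (i1.mul_prod i4).sub (i3.mul_prod i2)
  simp_rw [e]
  rw [← ofReal_integral_eq_lintegral_ofReal i5,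
    integral_sub (i1.mul_prod i4) (i3.mul_prod i2), integral_prod_mul, integral_prod_mul,
    integral_Ioi_id_gaussianReal, integral_Iic_id_gaussianReal,
    integral_indicator_one measurableSet_Ioi, integral_indicator_one measurableSet_Iic]
  · have h : (gaussianReal 0 1).real (Ioi s) + (gaussianReal 0 1).real (Iic s) = 1 := by
      rw [← compl_Iic, probReal_compl_eq_one_sub measurableSet_Iic]
      ring
    congr 1
    linear_combination (gaussianPDFReal 0 1 s) * h
  · refine Filter.Eventually.of_forall ?_
    rintro ⟨x, y⟩
    by_cases hx : s < x <;> by_cases hy : y ≤ s <;> simp [hx, hy]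
    linarith

lemma ofReal_sq_sub_le_lintegral_gapKernel {h : ℝ → ℝ} {K : ℝ≥0} (hh : LipschitzWith K h)
    {x y : ℝ} (hxy : y ≤ x) :
    ENNReal.ofReal ((h x - h y) ^ 2)
      ≤ ∫⁻ s, ENNReal.ofReal (deriv h s ^ 2) * gapKernel (x, y) s := by
  have hd : ∀ s, ‖deriv h s‖ ≤ K := fun s => norm_deriv_le_of_lipschitz hh
  have hm : Measurable (deriv h) := measurable_deriv h
  have e : ∀ s, ENNReal.ofReal (deriv h s ^ 2) * gapKernel (x, y) s
      = (Ico y x).indicator (fun s => ENNReal.ofReal ((x - y) * deriv h s ^ 2)) s := by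
    intro s
    by_cases hs : s ∈ Ico y x
    · simp only [gapKernel, hs, indicator_of_mem]
      rw [← ENNReal.ofReal_mul (sq_nonneg _), mul_comm]
    · simp [gapKernel, hs]
  simp_rw [e]
  rw [lintegral_indicator measurableSet_Ico, ← ofReal_integral_eq_lintegral_ofReal]
  · apply ENNReal.ofReal_le_ofReal
    rw [integral_const_mul, integral_Ico_eq_integral_Ioc,
      ← intervalIntegral.integral_of_le hxy]
    exact sq_sub_le_mul_integral_deriv_sq hh hxy
  · refine Measure.integrableOn_of_bounded (M := (x - y) * K ^ 2) (by simp)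
      (by fun_prop) (Filter.Eventually.of_forall fun s => ?_)
    have := pow_le_pow_left₀ (norm_nonneg _) (hd s) 2
    rw [norm_mul, norm_pow, Real.norm_of_nonneg (sub_nonneg.2 hxy)]
    exact mul_le_mul_of_nonneg_left this (sub_nonneg.2 hxy)
  · exact Filter.Eventually.of_forall fun s => mul_nonneg (sub_nonneg.2 hxy) (sq_nonneg _)

lemma integral_prod_sq_sub {Ω : Type*} [MeasurableSpace Ω] {μ : Measure Ω}
    [IsProbabilityMeasure μ] {f : Ω → ℝ} (hf : MemLp f 2 μ) :
    ∫ p, (f p.1 - f p.2) ^ 2 ∂(μ.prod μ) = 2 * Var[f; μ] := by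
  have i1 : Integrable (fun p : Ω × Ω => f p.1 ^ 2) (μ.prod μ) := hf.integrable_sq.comp_fst μ
  have i2 : Integrable (fun p : Ω × Ω => f p.2 ^ 2) (μ.prod μ) := hf.integrable_sq.comp_snd μ
  have hi : Integrable f μ := hf.integrable (by norm_num)
  have i3 : Integrable (fun p : Ω × Ω => f p.1 * f p.2) (μ.prod μ) := hi.mul_prod hi
  have i4 : Integrable (fun p : Ω × Ω => f p.1 ^ 2 + f p.2 ^ 2) (μ.prod μ) := i1.add i2
  have e : ∀ p : Ω × Ω, (f p.1 - f p.2) ^ 2 = f p.1 ^ 2 + f p.2 ^ 2 - 2 * (f p.1 * f p.2) :=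
    fun p => by ring
  simp_rw [e]
  rw [integral_sub i4 (i3.const_mul 2), integral_add i1 i2, integral_const_mul,
    integral_prod_mul, variance_eq_sub hf, integral_fun_fst (fun x => f x ^ 2),
    integral_fun_snd (fun x => f x ^ 2)]
  simp
  ring

lemma memLp_two_of_lipschitz {E : Type*} [NormedAddCommGroup E] [NormedSpace ℝ E]
    [MeasurableSpace E] [BorelSpace E] [SecondCountableTopology E] [CompleteSpace E]
    {μ : Measure E} [IsGaussian μ] {f : E → ℝ} {K : ℝ≥0} (hf : LipschitzWith K f) :
    MemLp f 2 μ := by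
  have hid : MemLp (fun g : E => K * ‖g‖ + |f 0|) 2 μ :=
    ((IsGaussian.memLp_two_id (μ := μ)).norm.const_mul _).add (memLp_const _)
  refine hid.mono hf.continuous.aestronglyMeasurable (Filter.Eventually.of_forall fun g => ?_)
  have h := hf.dist_le_mul g 0
  rw [Real.dist_eq, dist_zero_right] at h
  rw [Real.norm_eq_abs, Real.norm_of_nonneg (by positivity)]
  have := abs_sub_abs_le_abs_sub (f g) (f 0)
  linarith

/-- The Gaussian Poincaré inequality on the line, with its sharp constant. The variance is half of
the mean of `(h X - h Y)²`; bounding the square by Cauchy–Schwarz and integrating out `X`, `Y`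
leaves the Gaussian density as the weight of `h'(s)²`. -/
lemma variance_gaussianReal_le {h : ℝ → ℝ} {K : ℝ≥0} (hh : LipschitzWith K h) :
    Var[h; gaussianReal 0 1] ≤ ∫ s, deriv h s ^ 2 ∂(gaussianReal 0 1) := by
  set γ := gaussianReal 0 1 with hγ
  have hL : MemLp h 2 γ := memLp_two_of_lipschitz hh
  have hd : ∀ s, ‖deriv h s‖ ≤ K := fun s => norm_deriv_le_of_lipschitz hh
  have hm : Measurable (deriv h) := measurable_deriv h
  have hi : Integrable (fun s => deriv h s ^ 2) γ :=
    (integrable_const ((K : ℝ) ^ 2)).mono' (hm.pow_const 2).aestronglyMeasurable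
      (Filter.Eventually.of_forall fun s => by
        have := pow_le_pow_left₀ (norm_nonneg _) (hd s) 2
        simpa using this)
  let B : ℝ × ℝ → ENNReal := fun p => ∫⁻ s, ENNReal.ofReal (deriv h s ^ 2) * gapKernel p s
  have hBm : Measurable (Function.uncurry
      fun (p : ℝ × ℝ) (s : ℝ) => ENNReal.ofReal (deriv h s ^ 2) * gapKernel p s) :=
    (ENNReal.measurable_ofReal.comp ((hm.comp measurable_snd).pow_const 2)).mul
      measurable_gapKernel
  have hB : Measurable B := Measurable.lintegral_prod_right hBm
  have hBint : ∫⁻ p, B p ∂(γ.prod γ) = ∫⁻ s, ENNReal.ofReal (deriv h s ^ 2) ∂γ := by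
    have hswap := lintegral_lintegral_swap (μ := γ.prod γ) (ν := (volume : Measure ℝ))
      (f := fun p s => ENNReal.ofReal (deriv h s ^ 2) * gapKernel p s) hBm.aemeasurable
    simp only [B]
    rw [hswap, hγ, gaussianReal_of_var_ne_zero 0 one_ne_zero,
      lintegral_withDensity_eq_lintegral_mul _ (measurable_gaussianPDF 0 1) (by fun_prop),
      ← gaussianReal_of_var_ne_zero 0 one_ne_zero]
    refine lintegral_congr fun s => ?_
    have hk : Measurable fun p => gapKernel p s :=
      measurable_gapKernel.comp (measurable_id.prodMk measurable_const)
    rw [lintegral_const_mul _ hk,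
      lintegral_gapKernel, Pi.mul_apply, mul_comm]
    rfl
  have hle : ∫⁻ p, ENNReal.ofReal ((h p.1 - h p.2) ^ 2) ∂(γ.prod γ)
      ≤ ∫⁻ p, (B p + B p.swap) ∂(γ.prod γ) := by
    refine lintegral_mono ?_
    rintro ⟨x, y⟩
    rcases le_total y x with hxy | hxy
    · exact (ofReal_sq_sub_le_lintegral_gapKernel hh hxy).trans le_self_add
    · refine le_trans ?_ le_add_self
      have := ofReal_sq_sub_le_lintegral_gapKernel hh hxy
      rwa [show (h y - h x) ^ 2 = (h x - h y) ^ 2 by ring] at this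
  have hi2 : Integrable (fun p : ℝ × ℝ => (h p.1 - h p.2) ^ 2) (γ.prod γ) :=
    ((hL.comp_fst γ).sub (hL.comp_snd γ)).integrable_sq
  rw [lintegral_add_left hB, lintegral_prod_swap, hBint,
    ← ofReal_integral_eq_lintegral_ofReal hi
      (Filter.Eventually.of_forall fun s => sq_nonneg _),
    ← ofReal_integral_eq_lintegral_ofReal hi2
      (Filter.Eventually.of_forall fun s => sq_nonneg _),
    ← ENNReal.ofReal_add (integral_nonneg fun _ => sq_nonneg _)
      (integral_nonneg fun _ => sq_nonneg _),
    ENNReal.ofReal_le_ofReal_iff (add_nonneg (integral_nonneg fun _ => sq_nonneg _)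
      (integral_nonneg fun _ => sq_nonneg _))] at hle
  have h2 := integral_prod_sq_sub hL
  linarith

/-! ### The Gaussian Poincaré inequality for Lipschitz functions of several variables -/

/-- The Efron–Stein inequality for two factors: it amounts to
`0 ≤ ∫ (F - G - H + m)²` with `G`, `H` the two partial means and `m` the mean of `F`. -/
lemma variance_prod_le {α β : Type*} [MeasurableSpace α] [MeasurableSpace β] {μ : Measure α}
    {ν : Measure β} [IsProbabilityMeasure μ] [IsProbabilityMeasure ν] {F : α × β → ℝ}
    (hF : MemLp F 2 (μ.prod ν)) (hG : MemLp (fun x => ∫ y, F (x, y) ∂ν) 2 μ)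
    (hH : MemLp (fun y => ∫ x, F (x, y) ∂μ) 2 ν) (h1 : ∀ x, MemLp (fun y => F (x, y)) 2 ν)
    (h2 : ∀ y, MemLp (fun x => F (x, y)) 2 μ) :
    Var[F; μ.prod ν]
      ≤ ∫ x, Var[fun y => F (x, y); ν] ∂μ + ∫ y, Var[fun x => F (x, y); μ] ∂ν := by
  set G := fun x => ∫ y, F (x, y) ∂ν with hGdef
  set H := fun y => ∫ x, F (x, y) ∂μ with hHdef
  set m := ∫ p, F p ∂(μ.prod ν) with hm
  have iF : Integrable F (μ.prod ν) := hF.integrable (by norm_num)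
  have iFF : Integrable (fun p => F p ^ 2) (μ.prod ν) := hF.integrable_sq
  have iG : Integrable G μ := hG.integrable (by norm_num)
  have iH : Integrable H ν := hH.integrable (by norm_num)
  have iGG : Integrable (fun x => G x ^ 2) μ := hG.integrable_sq
  have iHH : Integrable (fun x => H x ^ 2) ν := hH.integrable_sq
  have iG' : Integrable (fun p : α × β => G p.1) (μ.prod ν) := iG.comp_fst ν
  have iH' : Integrable (fun p : α × β => H p.2) (μ.prod ν) := iH.comp_snd μ
  have iFG : Integrable (fun p : α × β => F p * G p.1) (μ.prod ν) :=
    hF.integrable_mul (hG.comp_fst ν)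
  have iFH : Integrable (fun p : α × β => F p * H p.2) (μ.prod ν) :=
    hF.integrable_mul (hH.comp_snd μ)
  have iGH : Integrable (fun p : α × β => G p.1 * H p.2) (μ.prod ν) := iG.mul_prod iH
  have iGG' : Integrable (fun p : α × β => G p.1 ^ 2) (μ.prod ν) := iGG.comp_fst ν
  have iHH' : Integrable (fun p : α × β => H p.2 ^ 2) (μ.prod ν) := iHH.comp_snd μ
  have eFG : ∫ p : α × β, F p * G p.1 ∂(μ.prod ν) = ∫ x, G x ^ 2 ∂μ := by
    rw [integral_prod _ iFG]
    refine integral_congr_ae (Filter.Eventually.of_forall fun x => ?_)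
    simp only [integral_mul_const]
    rw [pow_two]
  have eFH : ∫ p : α × β, F p * H p.2 ∂(μ.prod ν) = ∫ y, H y ^ 2 ∂ν := by
    rw [integral_prod_symm _ iFH]
    refine integral_congr_ae (Filter.Eventually.of_forall fun y => ?_)
    simp only [integral_mul_const]
    rw [pow_two]
  have eG : ∫ x, G x ∂μ = m := (integral_prod _ iF).symm
  have eH : ∫ y, H y ∂ν = m := (integral_prod_symm _ iF).symm
  have key : ∫ x, G x ^ 2 ∂μ + ∫ y, H y ^ 2 ∂ν ≤ ∫ p, F p ^ 2 ∂(μ.prod ν) + m ^ 2 := by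
    have hpos : 0 ≤ ∫ p : α × β, (F p - G p.1 - H p.2 + m) ^ 2 ∂(μ.prod ν) :=
      integral_nonneg fun _ => sq_nonneg _
    have e : ∀ p : α × β, (F p - G p.1 - H p.2 + m) ^ 2
        = F p ^ 2 + (G p.1 ^ 2 + (H p.2 ^ 2 + (m ^ 2 + ((-2) * (F p * G p.1)
          + ((-2) * (F p * H p.2) + (2 * m * F p + (2 * (G p.1 * H p.2)
          + ((-2) * m * G p.1 + (-2) * m * H p.2)))))))) := fun p => by ring
    simp_rw [e] at hpos
    have j1 : Integrable (fun p : α × β => (-2) * m * G p.1 + (-2) * m * H p.2) (μ.prod ν) :=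
      (iG'.const_mul _).add (iH'.const_mul _)
    have j2 := (iGH.const_mul 2).fun_add j1
    have j3 := (iF.const_mul (2 * m)).fun_add j2
    have j4 := (iFH.const_mul (-2)).fun_add j3
    have j5 := (iFG.const_mul (-2)).fun_add j4
    have j6 := (integrable_const (m ^ 2) (μ := μ.prod ν)).fun_add j5
    have j7 := iHH'.fun_add j6
    have j8 := iGG'.fun_add j7
    rw [integral_add iFF j8, integral_add iGG' j7, integral_add iHH' j6,
      integral_add (integrable_const _) j5, integral_add (iFG.const_mul _) j4,
      integral_add (iFH.const_mul _) j3, integral_add (iF.const_mul _) j2,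
      integral_add (iGH.const_mul _) j1,
      integral_add (iG'.const_mul _) (iH'.const_mul _), integral_const_mul, integral_const_mul,
      integral_const_mul, integral_const_mul, integral_const_mul, integral_const_mul, eFG, eFH,
      integral_prod_mul, integral_fun_fst (fun x => G x ^ 2), integral_fun_snd (fun x => H x ^ 2),
      integral_fun_fst G, integral_fun_snd H, eG, eH, ← hm] at hpos
    simp only [probReal_univ, integral_const, smul_eq_mul, one_mul] at hpos
    nlinarith
  have v1 : ∫ x, Var[fun y => F (x, y); ν] ∂μ
      = ∫ p, F p ^ 2 ∂(μ.prod ν) - ∫ x, G x ^ 2 ∂μ := by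
    rw [integral_prod _ iFF, ← integral_sub iFF.integral_prod_left iGG]
    refine integral_congr_ae (Filter.Eventually.of_forall fun x => ?_)
    exact variance_eq_sub (h1 x)
  have v2 : ∫ y, Var[fun x => F (x, y); μ] ∂ν
      = ∫ p, F p ^ 2 ∂(μ.prod ν) - ∫ y, H y ^ 2 ∂ν := by
    rw [integral_prod_symm _ iFF, ← integral_sub iFF.integral_prod_right iHH]
    refine integral_congr_ae (Filter.Eventually.of_forall fun y => ?_)
    exact variance_eq_sub (h2 y)
  rw [variance_eq_sub hF, v1, v2]
  simp only [Pi.pow_apply]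
  linarith

/-- The standard Gaussian measure on `ℝⁿ` with the sup norm. -/
noncomputable abbrev piGaussian (n : ℕ) : Measure (Fin n → ℝ) :=
  Measure.pi fun _ => gaussianReal 0 1

instance isGaussian_piGaussian (n : ℕ) : IsGaussian (piGaussian n) := by
  have h : (stdGaussian (Sig n)).map (EuclideanSpace.equiv (Fin n) ℝ) = piGaussian n := by
    rw [← map_pi_eq_stdGaussian, Measure.map_map (by fun_prop) (by fun_prop)]
    exact Measure.map_id
  rw [← h]
  infer_instance

lemma piGaussian_absolutelyContinuous : ∀ n : ℕ, piGaussian n ≪ volume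
  | 0 => by
    have : (volume : Measure (Fin 0 → ℝ)) = piGaussian 0 := by
      rw [volume_pi, Measure.pi_of_empty, piGaussian, Measure.pi_of_empty]
    rw [this]
  | n + 1 => by
    have h1 := (measurePreserving_piFinSuccAbove
      (fun _ : Fin (n + 1) => gaussianReal 0 1) 0).symm.map_eq
    have h2 := (volume_preserving_piFinSuccAbove (fun _ : Fin (n + 1) => ℝ) 0).symm.map_eq
    rw [piGaussian, ← h1, ← h2]
    exact ((gaussianReal_absolutelyContinuous 0 one_ne_zero).prod
      (piGaussian_absolutelyContinuous n)).map (MeasurableEquiv.measurable _)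

lemma lipschitz_integral {α β : Type*} [PseudoMetricSpace α] [MeasurableSpace β]
    {ν : Measure β} [IsProbabilityMeasure ν] {F : α → β → ℝ} {K : ℝ≥0}
    (hF : ∀ y, LipschitzWith K fun x => F x y) (hi : ∀ x, Integrable (F x) ν) :
    LipschitzWith K fun x => ∫ y, F x y ∂ν := by
  refine LipschitzWith.of_dist_le_mul fun x x' => ?_
  rw [Real.dist_eq, ← integral_sub (hi x) (hi x')]
  have h := norm_integral_le_of_norm_le_const (μ := ν) (f := fun y => F x y - F x' y)
    (C := K * dist x x') (Filter.Eventually.of_forall fun y => (hF y).dist_le_mul x x')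
  simpa using h

lemma lipschitz_cons (n : ℕ) :
    LipschitzWith 1 fun p : ℝ × (Fin n → ℝ) => (Fin.cons p.1 p.2 : Fin (n + 1) → ℝ) := by
  refine LipschitzWith.of_dist_le_mul fun p q => ?_
  rw [NNReal.coe_one, one_mul, dist_pi_le_iff dist_nonneg]
  intro i
  refine Fin.cases ?_ (fun j => ?_) i
  · exact le_max_left _ _
  · exact (dist_le_pi_dist p.2 q.2 j).trans (le_max_right _ _)

lemma integrable_lineDeriv_sq {n : ℕ} {F : (Fin n → ℝ) → ℝ} {K : ℝ≥0} (hF : LipschitzWith K F)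
    (v : Fin n → ℝ) : Integrable (fun x => lineDeriv ℝ F x v ^ 2) (piGaussian n) := by
  refine (integrable_const ((K * ‖v‖ : ℝ) ^ 2)).mono'
    ((measurable_lineDeriv hF.continuous).pow_const 2).aestronglyMeasurable
    (Filter.Eventually.of_forall fun x => ?_)
  have := pow_le_pow_left₀ (norm_nonneg _) (norm_lineDeriv_le_of_lipschitz ℝ hF (x₀ := x) (v := v)) 2
  simpa using this

/-- The Gaussian Poincaré inequality in terms of partial derivatives, by induction on the
dimension. -/
lemma variance_piGaussian_le (n : ℕ) : ∀ {F : (Fin n → ℝ) → ℝ} {K : ℝ≥0}, LipschitzWith K F →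
    Var[F; piGaussian n] ≤ ∑ i, ∫ x, lineDeriv ℝ F x (Pi.single i 1) ^ 2 ∂(piGaussian n) := by
  induction n with
  | zero =>
    intro F K hF
    have : F = fun _ => F 0 := by
      ext x
      rw [Subsingleton.elim x 0]
    rw [this, variance_eq_sub (memLp_const _)]
    simp
  | succ n ih =>
    intro F K hF
    set e := MeasurableEquiv.piFinSuccAbove (fun _ : Fin (n + 1) => ℝ) 0 with he
    have hmp : MeasurePreserving e.symm ((gaussianReal 0 1).prod (piGaussian n))
        (piGaussian (n + 1)) :=
      (measurePreserving_piFinSuccAbove (fun _ : Fin (n + 1) => gaussianReal 0 1) 0).symm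
    have hes : ∀ p : ℝ × (Fin n → ℝ), e.symm p = (Fin.cons p.1 p.2 : Fin (n + 1) → ℝ) := by
      intro p
      rw [he]
      simp
      rfl
    have hint : ∀ f : (Fin (n + 1) → ℝ) → ℝ, ∫ x, f x ∂(piGaussian (n + 1))
        = ∫ p : ℝ × (Fin n → ℝ), f (Fin.cons p.1 p.2)
          ∂((gaussianReal 0 1).prod (piGaussian n)) := by
      intro f
      rw [← hmp.integral_comp' f]
      simp_rw [hes]
    have hF' : LipschitzWith K fun p : ℝ × (Fin n → ℝ) =>
        F (Fin.cons p.1 p.2 : Fin (n + 1) → ℝ) := by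
      rw [← mul_one K]
      exact hF.comp (lipschitz_cons n)
    have hs1 : ∀ t : ℝ, LipschitzWith K fun y : Fin n → ℝ =>
        F (Fin.cons t y : Fin (n + 1) → ℝ) := fun t => by
      rw [← mul_one K]
      exact hF'.comp (LipschitzWith.prodMk_left t)
    have hs2 : ∀ y : Fin n → ℝ, LipschitzWith K fun t : ℝ =>
        F (Fin.cons t y : Fin (n + 1) → ℝ) := fun y => by
      rw [← mul_one K]
      exact hF'.comp (LipschitzWith.prodMk_right y)
    have d1 : ∀ (t : ℝ) (y : Fin n → ℝ) (i : Fin n),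
        lineDeriv ℝ F (Fin.cons t y : Fin (n + 1) → ℝ) (Pi.single i.succ 1)
          = lineDeriv ℝ (fun y : Fin n → ℝ => F (Fin.cons t y : Fin (n + 1) → ℝ)) y
              (Pi.single i 1) := by
      intro t y i
      unfold lineDeriv
      congr 1
      ext s
      congr 1
      ext j
      refine Fin.cases ?_ (fun j => ?_) j
      · simp [(Fin.succ_ne_zero i).symm]
      · simp [Pi.single_apply]
    have d0 : ∀ (t : ℝ) (y : Fin n → ℝ),
        lineDeriv ℝ F (Fin.cons t y : Fin (n + 1) → ℝ) (Pi.single 0 1)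
          = deriv (fun t : ℝ => F (Fin.cons t y : Fin (n + 1) → ℝ)) t := by
      intro t y
      have : (fun s : ℝ => F ((Fin.cons t y : Fin (n + 1) → ℝ) + s • Pi.single 0 1))
          = fun s : ℝ => (fun t : ℝ => F (Fin.cons t y : Fin (n + 1) → ℝ)) (t + s) := by
        ext s
        congr 1
        ext j
        refine Fin.cases ?_ (fun j => ?_) j
        · simp
        · simp
      rw [lineDeriv, this,
        deriv_comp_const_add (fun t : ℝ => F (Fin.cons t y : Fin (n + 1) → ℝ)) t 0, add_zero]
    have hvar : Var[F; piGaussian (n + 1)]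
        = Var[fun p : ℝ × (Fin n → ℝ) => F (Fin.cons p.1 p.2 : Fin (n + 1) → ℝ);
            (gaussianReal 0 1).prod (piGaussian n)] := by
      rw [← hmp.map_eq, variance_map_equiv]
      congr 1
      ext p
      rw [Function.comp_apply, hes]
    have hi : ∀ i, Integrable (fun p : ℝ × (Fin n → ℝ) =>
        lineDeriv ℝ F (Fin.cons p.1 p.2 : Fin (n + 1) → ℝ) (Pi.single i 1) ^ 2)
          ((gaussianReal 0 1).prod (piGaussian n)) := by
      intro i
      have := (hmp.integrable_comp_emb e.symm.measurableEmbedding).2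
        (integrable_lineDeriv_sq hF (Pi.single i 1))
      refine this.congr (Filter.Eventually.of_forall fun p => ?_)
      rw [Function.comp_apply, hes]
    rw [hvar]
    refine (variance_prod_le (memLp_two_of_lipschitz hF')
      (memLp_two_of_lipschitz (lipschitz_integral hs2
        fun t => (memLp_two_of_lipschitz (hs1 t)).integrable (by norm_num)))
      (memLp_two_of_lipschitz (lipschitz_integral hs1
        fun y => (memLp_two_of_lipschitz (hs2 y)).integrable (by norm_num)))
      (fun t => memLp_two_of_lipschitz (hs1 t))
      (fun y => memLp_two_of_lipschitz (hs2 y))).trans ?_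
    rw [Fin.sum_univ_succ, add_comm]
    refine add_le_add ?_ ?_
    · rw [hint, integral_prod_symm _ (hi 0)]
      refine integral_mono_of_nonneg (Filter.Eventually.of_forall fun y => variance_nonneg _ _)
        (hi 0).integral_prod_right (Filter.Eventually.of_forall fun y => ?_)
      simp_rw [d0]
      exact variance_gaussianReal_le (hs2 y)
    · simp_rw [hint]
      rw [← integral_finsetSum _ fun (i : Fin n) _ => hi i.succ, integral_prod]
      · refine integral_mono_of_nonneg (Filter.Eventually.of_forall fun y => variance_nonneg _ _)
          (integrable_finsetSum _ fun (i : Fin n) _ => hi i.succ).integral_prod_left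
          (Filter.Eventually.of_forall fun t => ?_)
        simp_rw [d1]
        rw [integral_finsetSum _ fun i _ => integrable_lineDeriv_sq (hs1 t) _]
        exact ih (hs1 t)
      · exact integrable_finsetSum _ fun (i : Fin n) _ => hi i.succ

/-- A `K`-Lipschitz function of a standard Gaussian vector has variance at most `K²`. -/
lemma variance_stdGaussian_le {n : ℕ} {f : Sig n → ℝ} {K : ℝ≥0} (hf : LipschitzWith K f) :
    Var[f; stdGaussian (Sig n)] ≤ K ^ 2 := by
  set F : (Fin n → ℝ) → ℝ := fun x => f (WithLp.toLp 2 x) with hF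
  have hFl := hf.comp (PiLp.lipschitzWith_toLp 2 (fun _ : Fin n => ℝ))
  have hvar : Var[f; stdGaussian (Sig n)] = Var[F; piGaussian n] := by
    rw [← map_pi_eq_stdGaussian, variance_map hf.continuous.aemeasurable (by fun_prop)]
    rfl
  have hae : ∀ᵐ x ∂(piGaussian n), ∑ i, lineDeriv ℝ F x (Pi.single i 1) ^ 2 ≤ (K : ℝ) ^ 2 := by
    filter_upwards [(piGaussian_absolutelyContinuous n).ae_le hFl.ae_differentiableAt] with x hx
    have hd : DifferentiableAt ℝ f (WithLp.toLp 2 x) := by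
      have hx' : DifferentiableAt ℝ F (EuclideanSpace.equiv (Fin n) ℝ (WithLp.toLp 2 x)) := hx
      exact hx'.comp (WithLp.toLp 2 x)
        (EuclideanSpace.equiv (Fin n) ℝ).differentiableAt
    have hl : ∀ i, lineDeriv ℝ F x (Pi.single i 1)
        = fderiv ℝ f (WithLp.toLp 2 x) (EuclideanSpace.basisFun (Fin n) ℝ i) := by
      intro i
      rw [← hd.lineDeriv_eq_fderiv, lineDeriv, lineDeriv]
      congr 1
      ext s
      simp only [hF]
      congr 1
      ext j
      simp [Pi.single_apply]
    have hn := (EuclideanSpace.basisFun (Fin n) ℝ).norm_dual (fderiv ℝ f (WithLp.toLp 2 x))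
    simp_rw [hl]
    calc ∑ i, fderiv ℝ f (WithLp.toLp 2 x) (EuclideanSpace.basisFun (Fin n) ℝ i) ^ 2
        = ‖fderiv ℝ f (WithLp.toLp 2 x)‖ ^ 2 := by
          rw [hn]
      _ ≤ (K : ℝ) ^ 2 := pow_le_pow_left₀ (norm_nonneg _) (norm_fderiv_le_of_lipschitz ℝ hf) 2
  rw [hvar]
  refine (variance_piGaussian_le n hFl).trans ?_
  rw [← integral_finsetSum _ fun i _ => integrable_lineDeriv_sq hFl _]
  refine (integral_mono_ae (integrable_finsetSum _ fun i _ => integrable_lineDeriv_sq hFl _)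
    (integrable_const ((K : ℝ) ^ 2)) hae).trans ?_
  simp

/-! ### Soft thresholding of a standard normal variable -/

/-- The excess `(|a| - τ)₊` of `|a|` over the level `τ`, which for `τ ≥ 0` is the distance of `a`
from `[-τ, τ]`. -/
noncomputable def excess (τ a : ℝ) : ℝ := max (|a| - τ) 0

/-- The point of `[-τ, τ]` closest to `a`, for `τ ≥ 0`. -/
noncomputable def clip (τ a : ℝ) : ℝ := max (-τ) (min a τ)

lemma excess_nonneg (τ a : ℝ) : 0 ≤ excess τ a := le_max_right _ _

lemma abs_clip_le {τ : ℝ} (hτ : 0 ≤ τ) (a : ℝ) : |clip τ a| ≤ τ := by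
  rw [abs_le, clip]
  grind

lemma abs_sub_clip {τ : ℝ} (hτ : 0 ≤ τ) (a : ℝ) : |a - clip τ a| = excess τ a := by
  rw [clip, excess]
  grind

lemma clip_mul_sub_clip {τ : ℝ} (hτ : 0 ≤ τ) (a : ℝ) :
    clip τ a * (a - clip τ a) = τ * excess τ a := by
  rw [clip, excess]
  rcases le_total a τ with h1 | h1 <;> rcases le_total (-τ) a with h2 | h2
  · rw [min_eq_left h1, max_eq_right h2, max_eq_right (by linarith [abs_le.2 ⟨h2, h1⟩])]
    ring
  · rw [min_eq_left h1, max_eq_left h2, abs_of_nonpos (by linarith), max_eq_left (by linarith)]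
    ring
  · rw [min_eq_right h1, max_eq_right (by linarith), abs_of_nonneg (by linarith),
      max_eq_left (by linarith)]
  · rw [min_eq_right h1, max_eq_right (by linarith), abs_of_nonneg (by linarith),
      max_eq_left (by linarith)]

lemma excess_le_abs_sub {τ a z : ℝ} (hz : |z| ≤ τ) : excess τ a ≤ |a - z| := by
  rw [excess]
  refine max_le ?_ (abs_nonneg _)
  linarith [abs_sub_abs_le_abs_sub a z]

/-- The tangent inequality for the convex function `τ ↦ (|a| - τ)₊²`. -/
lemma excess_sq_tangent (σ τ a : ℝ) :
    excess τ a ^ 2 + 2 * (σ - τ) * (-excess τ a) ≤ excess σ a ^ 2 := by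
  rw [excess, excess]
  rcases le_total (|a| - τ) 0 with h1 | h1 <;> rcases le_total (|a| - σ) 0 with h2 | h2
  · rw [max_eq_right h1, max_eq_right h2]; simp
  · rw [max_eq_right h1, max_eq_left h2]; simp; positivity
  · rw [max_eq_left h1, max_eq_right h2]; nlinarith
  · rw [max_eq_left h1, max_eq_left h2]; nlinarith [sq_nonneg (σ - τ)]

lemma lipschitz_excess_left (a : ℝ) : LipschitzWith 1 fun τ => excess τ a := by
  refine LipschitzWith.of_le_add fun τ σ => ?_
  have h := neg_abs_le (τ - σ)
  rw [Real.dist_eq, excess, excess]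
  refine max_le ?_ (add_nonneg (le_max_right _ _) (abs_nonneg _))
  linarith [le_max_left (|a| - σ) 0]

lemma lipschitz_excess_right (τ : ℝ) : LipschitzWith 1 (excess τ) := by
  refine LipschitzWith.of_le_add fun a b => ?_
  have h := abs_sub_abs_le_abs_sub a b
  rw [Real.dist_eq, excess, excess]
  refine max_le ?_ (add_nonneg (le_max_right _ _) (abs_nonneg _))
  linarith [le_max_left (|b| - τ) 0]

lemma excess_antitone (a : ℝ) {σ τ : ℝ} (h : σ ≤ τ) : excess τ a ≤ excess σ a :=
  max_le_max (by linarith) le_rfl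

lemma memLp_excess (τ : ℝ) : MemLp (excess τ) 2 (gaussianReal 0 1) :=
  memLp_two_of_lipschitz (lipschitz_excess_right τ)

lemma integrable_excess (τ : ℝ) : Integrable (excess τ) (gaussianReal 0 1) :=
  (memLp_excess τ).integrable (by norm_num)

/-- The mean of `(|g| - τ)₊` for a standard normal variable `g`. -/
noncomputable def meanExcess (τ : ℝ) : ℝ := ∫ a, excess τ a ∂(gaussianReal 0 1)

/-- The mean of `(|g| - τ)₊²` for a standard normal variable `g`. -/
noncomputable def meanSqExcess (τ : ℝ) : ℝ := ∫ a, excess τ a ^ 2 ∂(gaussianReal 0 1)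

lemma continuous_meanExcess : Continuous meanExcess :=
  (lipschitz_integral lipschitz_excess_left integrable_excess).continuous

lemma meanExcess_antitone {σ τ : ℝ} (h : σ ≤ τ) : meanExcess τ ≤ meanExcess σ :=
  integral_mono (integrable_excess τ) (integrable_excess σ) fun a => excess_antitone a h

lemma sqrt_two_div_pi : √(2 / Real.pi) = 2 * (√(2 * Real.pi))⁻¹ := by
  rw [Real.sqrt_eq_iff_mul_self_eq (by positivity) (by positivity)]
  have h : (√(2 * Real.pi))⁻¹ * (√(2 * Real.pi))⁻¹ = (2 * Real.pi)⁻¹ := by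
    rw [← mul_inv, Real.mul_self_sqrt (by positivity)]
  rw [show ∀ z : ℝ, 2 * z * (2 * z) = 4 * (z * z) from fun z => by ring, h]
  field_simp
  norm_num

lemma integral_abs_gaussianReal : ∫ a, |a| ∂(gaussianReal 0 1) = √(2 / Real.pi) := by
  rw [integral_gaussianReal_eq_integral_smul one_ne_zero]
  have e : ∀ a : ℝ, gaussianPDFReal 0 1 a • |a| = (fun t => t * gaussianPDFReal 0 1 t) |a| := by
    intro a
    simp only [gaussianPDFReal_zero_one, sq_abs, smul_eq_mul]
    ring
  simp_rw [e]
  rw [integral_comp_abs (f := fun t => t * gaussianPDFReal 0 1 t)]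
  have h := integral_Ioi_id_gaussianReal 0
  rw [integral_gaussianReal_eq_integral_smul one_ne_zero] at h
  have h2 : ∫ x in Ioi 0, x * gaussianPDFReal 0 1 x = gaussianPDFReal 0 1 0 := by
    rw [← h, ← integral_indicator measurableSet_Ioi]
    refine integral_congr_ae (Filter.Eventually.of_forall fun x => ?_)
    by_cases hx : x ∈ Ioi (0 : ℝ) <;> simp [hx, mul_comm]
  rw [h2, gaussianPDFReal_zero_one, sqrt_two_div_pi]
  simp

lemma meanExcess_zero : meanExcess 0 = √(2 / Real.pi) := by
  rw [meanExcess, ← integral_abs_gaussianReal]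
  simp [excess]

lemma meanSqExcess_eq {τ : ℝ} (hτ : 0 ≤ τ) :
    meanSqExcess τ
      = √(2 / Real.pi) * ∫ w in Ioi τ, (w - τ) ^ 2 * Real.exp (-(w ^ 2) / 2) := by
  rw [meanSqExcess, integral_gaussianReal_eq_integral_smul one_ne_zero]
  have e : ∀ a : ℝ, gaussianPDFReal 0 1 a • excess τ a ^ 2
      = (fun t => (√(2 * Real.pi))⁻¹ * (max (t - τ) 0 ^ 2 * Real.exp (-(t ^ 2) / 2))) |a| := by
    intro a
    simp only [gaussianPDFReal_zero_one, sq_abs, smul_eq_mul, excess]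
    ring
  simp_rw [e]
  rw [integral_comp_abs
    (f := fun t => (√(2 * Real.pi))⁻¹ * (max (t - τ) 0 ^ 2 * Real.exp (-(t ^ 2) / 2))),
    integral_const_mul, sqrt_two_div_pi, ← mul_assoc]
  congr 1
  rw [← integral_indicator measurableSet_Ioi, ← integral_indicator measurableSet_Ioi]
  refine integral_congr_ae (Filter.Eventually.of_forall fun w => ?_)
  by_cases hw : τ < w
  · have h0 : 0 < w := hτ.trans_lt hw
    simp [hw, h0, max_eq_left (sub_pos.2 hw).le]
  · have : max (w - τ) 0 = 0 := max_eq_right (by linarith [not_lt.1 hw])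
    simp [hw, indicator, this]

lemma measurePreserving_inner_stdGaussian {n : ℕ} {v : Sig n} (hv : ‖v‖ = 1) :
    MeasurePreserving (fun g : Sig n => ⟪v, g⟫) (stdGaussian (Sig n)) (gaussianReal 0 1) := by
  refine ⟨by fun_prop, ?_⟩
  have h := IsGaussian.map_eq_gaussianReal (μ := stdGaussian (Sig n)) (innerSL ℝ v)
  rw [variance_dual_stdGaussian, integral_strongDual_stdGaussian, innerSL_apply_norm, hv] at h
  simpa using h

lemma measurePreserving_apply_stdGaussian {n : ℕ} (i : Fin n) :
    MeasurePreserving (fun g : Sig n => g i) (stdGaussian (Sig n)) (gaussianReal 0 1) := by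
  have h := measurePreserving_inner_stdGaussian (v := EuclideanSpace.single i (1 : ℝ)) (by simp)
  simpa [EuclideanSpace.inner_single_left] using h

lemma integral_apply_stdGaussian {n : ℕ} (i : Fin n) {f : ℝ → ℝ} (hf : Continuous f) :
    ∫ g, f (g i) ∂(stdGaussian (Sig n)) = ∫ a, f a ∂(gaussianReal 0 1) := by
  rw [← (measurePreserving_apply_stdGaussian i).map_eq, integral_map (by fun_prop)
    hf.aestronglyMeasurable]

variable {n : ℕ}

/-! ### The subdifferential of the `ℓ₁` norm and the distance to its dilates -/

lemma abs_sign_le_one (a : ℝ) : |(SignType.sign a : ℝ)| ≤ 1 := by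
  rcases lt_trichotomy a 0 with h | h | h <;> simp [h]

lemma sign_sq {a : ℝ} (h : a ≠ 0) : (SignType.sign a : ℝ) ^ 2 = 1 := by
  rcases h.lt_or_gt with h | h <;> simp [h]

lemma mem_subdiff_l1 {x w : Sig n} :
    w ∈ subdiff l1 x ↔ ∀ i, if x i ≠ 0 then w i = SignType.sign (x i) else |w i| ≤ 1 := by
  constructor
  · intro h i
    have hstep : ∀ t : ℝ, w i * t ≤ |x i + t| - |x i| := by
      intro t
      have h1 := h (x + EuclideanSpace.single i t)
      have h2 : l1 (x + EuclideanSpace.single i t) - l1 x = |x i + t| - |x i| := by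
        rw [l1, l1, ← Finset.sum_sub_distrib, Finset.sum_eq_single i]
        · simp
        · intro j _ hj
          simp [hj]
        · simp
      rw [add_sub_cancel_left, EuclideanSpace.inner_single_right] at h1
      simp at h1
      linarith
    split_ifs with hx
    · have h1 := hstep (-x i)
      have h2 := hstep (x i)
      have h3 : |x i + x i| = 2 * |x i| := by rw [← two_mul, abs_mul]; simp
      rw [add_neg_cancel, abs_zero] at h1
      rw [h3] at h2
      have h4 : w i * x i = SignType.sign (x i) * x i := by
        rw [sign_mul_self]
        linarith
      exact mul_right_cancel₀ hx h4
    · rw [not_not] at hx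
      have h1 := hstep 1
      have h2 := hstep (-1)
      simp only [hx, zero_add, abs_one, abs_neg, abs_zero] at h1 h2
      exact abs_le.2 ⟨by linarith, by linarith⟩
  · intro h y
    rw [PiLp.inner_apply, l1, l1, ← Finset.sum_add_distrib]
    refine Finset.sum_le_sum fun i _ => ?_
    have hi := h i
    simp only [PiLp.sub_apply, RCLike.inner_apply, conj_trivial]
    have hw : |w i| ≤ 1 := by
      split_ifs at hi
      · rw [hi]; exact abs_sign_le_one _
      · exact hi
    have hwx : w i * x i = |x i| := by
      split_ifs at hi with hx
      · rw [hi, sign_mul_self]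
      · rw [not_not] at hx
        simp [hx]
    have hwy : w i * y i ≤ |y i| := by
      calc w i * y i ≤ |w i * y i| := le_abs_self _
        _ = |w i| * |y i| := abs_mul _ _
        _ ≤ 1 * |y i| := by gcongr
        _ = |y i| := one_mul _
    linarith

lemma inner_eq_l1_of_mem_subdiff {x w : Sig n} (hw : w ∈ subdiff l1 x) : ⟪x, w⟫ = l1 x := by
  rw [PiLp.inner_apply, l1]
  refine Finset.sum_congr rfl fun i _ => ?_
  have hi := mem_subdiff_l1.1 hw i
  simp only [RCLike.inner_apply, conj_trivial]
  split_ifs at hi with hx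
  · rw [hi, sign_mul_self]
  · rw [not_not] at hx
    simp [hx]

/-- The entries on the support of `x` of the elements of `Q_x⁻¹ ∂‖·‖₁(x)`. It vanishes off the
support. -/
noncomputable def dualEntry (x : Sig n) (i : Fin n) : ℝ :=
  SignType.sign (x i) - (1 - √(2 / Real.pi)) * l1 x * x i

lemma dualEntry_of_eq_zero {x : Sig n} {i : Fin n} (h : x i = 0) : dualEntry x i = 0 := by
  simp [dualEntry, h]

lemma mem_preimage_Q_subdiff {x : Sig n} (hx : ‖x‖ = 1) {q : Sig n} :
    q ∈ Q x ⁻¹' subdiff l1 x ↔ ∀ i, if x i ≠ 0 then q i = dualEntry x i else |q i| ≤ 1 := by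
  rw [preimage_Q x hx]
  constructor
  · rintro ⟨w, hw, rfl⟩ i
    have hi := mem_subdiff_l1.1 hw i
    simp only [PiLp.sub_apply, PiLp.smul_apply, smul_eq_mul, inner_eq_l1_of_mem_subdiff hw]
    split_ifs at hi ⊢ with h0
    · rw [hi, dualEntry]
    · rw [not_not] at h0
      simpa [h0] using hi
  · intro h
    have hw : q + ((1 - √(2 / Real.pi)) * l1 x) • x ∈ subdiff l1 x := by
      refine mem_subdiff_l1.2 fun i => ?_
      have hi := h i
      simp only [PiLp.add_apply, PiLp.smul_apply, smul_eq_mul]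
      split_ifs at hi ⊢ with h0
      · rw [hi, dualEntry]; ring
      · rw [not_not] at h0
        simpa [h0] using hi
    refine ⟨_, hw, ?_⟩
    simp only [inner_eq_l1_of_mem_subdiff hw, add_sub_cancel_right]

lemma mem_smul_preimage_Q_subdiff {x : Sig n} (hx : ‖x‖ = 1) {τ : ℝ} (hτ : 0 ≤ τ) {q : Sig n} :
    q ∈ τ • (Q x ⁻¹' subdiff l1 x)
      ↔ ∀ i, if x i ≠ 0 then q i = τ * dualEntry x i else |q i| ≤ τ := by
  constructor
  · rintro ⟨r, hr, rfl⟩ i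
    have hi := (mem_preimage_Q_subdiff hx).1 hr i
    simp only [PiLp.smul_apply, smul_eq_mul]
    split_ifs at hi ⊢
    · rw [hi]
    · rw [abs_mul, abs_of_nonneg hτ]
      exact mul_le_of_le_one_right hτ hi
  · intro h
    rcases hτ.eq_or_lt with rfl | hpos
    · -- for `τ = 0` the conditions force `q = 0`, and `Q_x⁻¹ ∂f(x)` is non-empty
      have hq : q = 0 := by
        ext i
        have hi := h i
        split_ifs at hi
        · simpa using hi
        · simpa using hi
      refine ⟨WithLp.toLp 2 (dualEntry x), (mem_preimage_Q_subdiff hx).2 fun i => ?_, ?_⟩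
      · split_ifs with h0
        · rfl
        · rw [not_not] at h0
          simp [dualEntry_of_eq_zero h0]
      · simp [hq]
    · refine ⟨τ⁻¹ • q, (mem_preimage_Q_subdiff hx).2 fun i => ?_, ?_⟩
      · have hi := h i
        simp only [PiLp.smul_apply, smul_eq_mul]
        split_ifs at hi ⊢
        · rw [hi]; field_simp
        · rw [abs_mul, abs_of_pos (inv_pos.2 hpos)]
          exact (inv_mul_le_one₀ hpos).2 hi
      · simp [smul_smul, hpos.ne']

/-- The point of `τ • Q_x⁻¹ ∂‖·‖₁(x)` closest to `g`. -/
noncomputable def dualProj (x : Sig n) (τ : ℝ) (g : Sig n) : Sig n :=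
  WithLp.toLp 2 fun i => if x i ≠ 0 then τ * dualEntry x i else clip τ (g i)

/-- The squared distance of `g` to `τ • Q_x⁻¹ ∂‖·‖₁(x)`. -/
noncomputable def distSq (x : Sig n) (τ : ℝ) (g : Sig n) : ℝ :=
  ∑ i, if x i ≠ 0 then (g i - τ * dualEntry x i) ^ 2 else excess τ (g i) ^ 2

/-- Half of the derivative of `distSq x τ g` in `τ`. -/
noncomputable def distSlope (x : Sig n) (τ : ℝ) (g : Sig n) : ℝ :=
  ∑ i, if x i ≠ 0 then dualEntry x i * (τ * dualEntry x i - g i) else -excess τ (g i)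

lemma norm_sq_sub_dualProj (x : Sig n) {τ : ℝ} (hτ : 0 ≤ τ) (g : Sig n) :
    ‖g - dualProj x τ g‖ ^ 2 = distSq x τ g := by
  rw [EuclideanSpace.real_norm_sq_eq, distSq]
  refine Finset.sum_congr rfl fun i _ => ?_
  simp only [PiLp.sub_apply, dualProj]
  split_ifs
  · rfl
  · rw [← sq_abs, abs_sub_clip hτ]

lemma dualProj_mem {x : Sig n} (hx : ‖x‖ = 1) {τ : ℝ} (hτ : 0 ≤ τ) (g : Sig n) :
    dualProj x τ g ∈ τ • (Q x ⁻¹' subdiff l1 x) := by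
  refine (mem_smul_preimage_Q_subdiff hx hτ).2 fun i => ?_
  simp only [dualProj]
  split_ifs
  · rfl
  · exact abs_clip_le hτ _

lemma infDist_sq_eq {x : Sig n} (hx : ‖x‖ = 1) {τ : ℝ} (hτ : 0 ≤ τ) (g : Sig n) :
    Metric.infDist g (τ • (Q x ⁻¹' subdiff l1 x)) ^ 2 = distSq x τ g := by
  rw [← norm_sq_sub_dualProj x hτ]
  congr 1
  refine le_antisymm ?_ ?_
  · rw [← dist_eq_norm]
    exact Metric.infDist_le_dist_of_mem (dualProj_mem hx hτ g)
  · refine (Metric.le_infDist ⟨_, dualProj_mem hx hτ g⟩).2 fun q hq => ?_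
    rw [dist_eq_norm]
    refine le_of_sq_le_sq ?_ (norm_nonneg _)
    rw [norm_sq_sub_dualProj x hτ, EuclideanSpace.real_norm_sq_eq, distSq]
    refine Finset.sum_le_sum fun i _ => ?_
    have hi := (mem_smul_preimage_Q_subdiff hx hτ).1 hq i
    simp only [PiLp.sub_apply]
    split_ifs at hi ⊢
    · rw [hi]
    · rw [← sq_abs (g i - q i)]
      exact pow_le_pow_left₀ (excess_nonneg _ _) (excess_le_abs_sub hi) 2

/-- The tangent inequality for the convex function `τ ↦ distSq x τ g`. -/
lemma distSq_tangent (x : Sig n) (σ τ : ℝ) (g : Sig n) :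
    distSq x τ g + 2 * (σ - τ) * distSlope x τ g ≤ distSq x σ g := by
  rw [distSq, distSq, distSlope, Finset.mul_sum, ← Finset.sum_add_distrib]
  refine Finset.sum_le_sum fun i _ => ?_
  split_ifs
  · nlinarith [sq_nonneg ((σ - τ) * dualEntry x i)]
  · exact excess_sq_tangent σ τ (g i)

/-! ### Their means -/

lemma sum_ite_support {x : Sig n} {s : ℕ} (hs : nnzEntries x = s) (a b : ℝ) :
    (∑ i, if x i ≠ 0 then a else b) = s * a + (n - s) * b := by
  have h : ∀ i, (if x i ≠ 0 then a else b) = (if x i ≠ 0 then a - b else 0) + b := by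
    intro i
    split_ifs <;> ring
  simp_rw [h]
  rw [Finset.sum_add_distrib, ← Finset.sum_filter, Finset.sum_const, Finset.sum_const,
    show (Finset.univ.filter fun i => x i ≠ 0).card = s from hs]
  simp
  ring

lemma sum_sq_eq_one {x : Sig n} (hx : ‖x‖ = 1) : ∑ i, x i ^ 2 = 1 := by
  rw [← EuclideanSpace.real_norm_sq_eq, hx, one_pow]

lemma l1_pos {x : Sig n} (hx : ‖x‖ = 1) : 0 < l1 x := by
  have h0 : 0 ≤ l1 x := Finset.sum_nonneg fun i _ => abs_nonneg _
  refine h0.lt_of_ne fun h => ?_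
  have h1 := (Finset.sum_eq_zero_iff_of_nonneg fun i _ => abs_nonneg (x i)).1 h.symm
  have h2 : ∑ i, x i ^ 2 = 0 := Finset.sum_eq_zero fun i hi => by
    rw [abs_eq_zero.1 (h1 i hi)]; norm_num
  rw [sum_sq_eq_one hx] at h2
  norm_num at h2

/-- The defect in the Cauchy–Schwarz inequality `‖x‖₁² ≤ s`, as a sum of squares. -/
lemma sum_sub_sq_eq {x : Sig n} {s : ℕ} (hx : ‖x‖ = 1) (hs : nnzEntries x = s) :
    (∑ i, if x i ≠ 0 then (s * |x i| - l1 x) ^ 2 else 0) = s * (s - l1 x ^ 2) := by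
  have h : ∀ i, (if x i ≠ 0 then (s * |x i| - l1 x) ^ 2 else 0)
      = (s : ℝ) ^ 2 * x i ^ 2 - 2 * s * l1 x * |x i| + if x i ≠ 0 then l1 x ^ 2 else 0 := by
    intro i
    split_ifs with h0
    · rw [← sq_abs (x i)]; ring
    · rw [not_not] at h0
      simp [h0]
  simp_rw [h]
  rw [Finset.sum_add_distrib, Finset.sum_sub_distrib, ← Finset.mul_sum, ← Finset.mul_sum,
    sum_ite_support hs, sum_sq_eq_one hx, ← l1]
  ring

lemma support_pos {x : Sig n} {s : ℕ} (hx : ‖x‖ = 1) (hs : nnzEntries x = s) : 0 < s := by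
  rw [← hs, nnzEntries, Finset.card_pos]
  by_contra h
  rw [Finset.not_nonempty_iff_eq_empty, Finset.filter_eq_empty_iff] at h
  have h2 : ∑ i, x i ^ 2 = 0 := Finset.sum_eq_zero fun i hi => by
    have := h hi
    rw [not_not] at this
    rw [this]; norm_num
  rw [sum_sq_eq_one hx] at h2
  norm_num at h2

lemma support_le {x : Sig n} {s : ℕ} (hs : nnzEntries x = s) : s ≤ n := by
  rw [← hs, nnzEntries]
  exact (Finset.card_le_univ _).trans (by simp)

lemma l1_sq_le {x : Sig n} {s : ℕ} (hx : ‖x‖ = 1) (hs : nnzEntries x = s) : l1 x ^ 2 ≤ s := by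
  have h := sum_sub_sq_eq hx hs
  have h0 : 0 ≤ ∑ i, if x i ≠ 0 then (s * |x i| - l1 x) ^ 2 else 0 :=
    Finset.sum_nonneg fun i _ => by split_ifs <;> positivity
  have hsp : (0 : ℝ) < s := by exact_mod_cast support_pos hx hs
  rw [h] at h0
  nlinarith [nonneg_of_mul_nonneg_right h0 hsp]

lemma equalAmplitude_iff {x : Sig n} {s : ℕ} (hx : ‖x‖ = 1) (hs : nnzEntries x = s) :
    EqualAmplitude x ↔ l1 x ^ 2 = s := by
  have h := sum_sub_sq_eq hx hs
  have hsp : (0 : ℝ) < s := by exact_mod_cast support_pos hx hs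
  have hnn : ∀ i ∈ Finset.univ, 0 ≤ if x i ≠ 0 then (s * |x i| - l1 x) ^ 2 else 0 :=
    fun i _ => by split_ifs <;> positivity
  constructor
  · intro he
    have hz : (∑ i, if x i ≠ 0 then (s * |x i| - l1 x) ^ 2 else 0) = 0 := by
      refine Finset.sum_eq_zero fun i _ => ?_
      split_ifs with h0
      · have hl : l1 x = s * |x i| := by
          have : ∀ j, |x j| = if x j ≠ 0 then |x i| else 0 := by
            intro j
            split_ifs with hj
            · exact he j i hj h0
            · rw [not_not] at hj
              simp [hj]
          rw [l1, Finset.sum_congr rfl fun j _ => this j, sum_ite_support hs]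
          ring
        rw [hl]; ring
      · rfl
    rw [hz] at h
    rcases mul_eq_zero.1 h.symm with h1 | h1 <;> linarith
  · intro hl i j hi hj
    rw [hl, sub_self, mul_zero] at h
    have h1 := (Finset.sum_eq_zero_iff_of_nonneg hnn).1 h i (Finset.mem_univ _)
    have h2 := (Finset.sum_eq_zero_iff_of_nonneg hnn).1 h j (Finset.mem_univ _)
    rw [if_pos hi] at h1
    rw [if_pos hj] at h2
    have h3 := pow_eq_zero_iff (two_ne_zero) |>.1 h1
    have h4 := pow_eq_zero_iff (two_ne_zero) |>.1 h2
    exact mul_left_cancel₀ hsp.ne' (by linarith)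

lemma sum_dualEntry_sq {x : Sig n} {s : ℕ} (hx : ‖x‖ = 1) (hs : nnzEntries x = s) :
    ∑ i, dualEntry x i ^ 2 = s - l1 x ^ 2 * (1 - 2 / Real.pi) := by
  have h : ∀ i, dualEntry x i ^ 2 = (if x i ≠ 0 then 1 else 0)
      - 2 * (1 - √(2 / Real.pi)) * l1 x * |x i|
      + ((1 - √(2 / Real.pi)) * l1 x) ^ 2 * x i ^ 2 := by
    intro i
    split_ifs with h0
    · rw [dualEntry, ← sign_mul_self (x i), ← sign_sq h0]; ring
    · rw [not_not] at h0
      simp [dualEntry_of_eq_zero h0, h0]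
  simp_rw [h]
  rw [Finset.sum_add_distrib, Finset.sum_sub_distrib, ← Finset.mul_sum, ← Finset.mul_sum,
    sum_ite_support hs, sum_sq_eq_one hx, ← l1]
  have hq : √(2 / Real.pi) ^ 2 = 2 / Real.pi := Real.sq_sqrt (by positivity)
  linear_combination l1 x ^ 2 * hq

lemma sum_dualEntry_sq_pos {x : Sig n} (hx : ‖x‖ = 1) : 0 < ∑ i, dualEntry x i ^ 2 := by
  rw [sum_dualEntry_sq hx rfl]
  have h1 := l1_sq_le hx rfl
  have h2 : (0 : ℝ) < nnzEntries x := by exact_mod_cast support_pos hx rfl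
  have h3 : 0 < 2 / Real.pi := by positivity
  have h4 : 2 / Real.pi ≤ 1 := (div_le_one Real.pi_pos).2 Real.two_le_pi
  nlinarith [mul_nonneg (sub_nonneg.2 h1) (sub_nonneg.2 h4)]

lemma memLp_apply_stdGaussian (i : Fin n) :
    MemLp (fun g : Sig n => g i) 2 (stdGaussian (Sig n)) :=
  (memLp_id_gaussianReal 2).comp_measurePreserving (measurePreserving_apply_stdGaussian i)

lemma integral_sq_gaussianReal : ∫ a, a ^ 2 ∂(gaussianReal 0 1) = 1 := by
  have h := variance_eq_sub (memLp_id_gaussianReal (μ := 0) (v := 1) 2)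
  rw [variance_id_gaussianReal] at h
  simpa using h.symm

/-- The mean of `distSq x τ`, for a signal with `s` non-zero entries. -/
noncomputable def meanDistSq (n s : ℕ) (L τ : ℝ) : ℝ :=
  s + τ ^ 2 * (s - L ^ 2 * (1 - 2 / Real.pi)) + (n - s) * meanSqExcess τ

/-- The mean of `distSlope x τ`, for a signal with `s` non-zero entries. -/
noncomputable def meanDistSlope (n s : ℕ) (L τ : ℝ) : ℝ :=
  τ * (s - L ^ 2 * (1 - 2 / Real.pi)) - (n - s) * meanExcess τ

lemma integral_distSq {x : Sig n} {s : ℕ} (hx : ‖x‖ = 1) (hs : nnzEntries x = s) (τ : ℝ) :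
    ∫ g, distSq x τ g ∂(stdGaussian (Sig n)) = meanDistSq n s (l1 x) τ := by
  have hm : ∀ i, MemLp (fun g : Sig n => excess τ (g i)) 2 (stdGaussian (Sig n)) := fun i =>
    (memLp_excess τ).comp_measurePreserving (measurePreserving_apply_stdGaussian i)
  have hi : ∀ i ∈ Finset.univ, Integrable (fun g : Sig n => if x i ≠ 0 then
      (g i - τ * dualEntry x i) ^ 2 else excess τ (g i) ^ 2) (stdGaussian (Sig n)) := by
    intro i _
    split_ifs
    · exact ((memLp_apply_stdGaussian i).sub (memLp_const _)).integrable_sq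
    · exact (hm i).integrable_sq
  have he : ∀ i, ∫ g : Sig n, (if x i ≠ 0 then
      (g i - τ * dualEntry x i) ^ 2 else excess τ (g i) ^ 2) ∂(stdGaussian (Sig n))
      = (if x i ≠ 0 then 1 else meanSqExcess τ) + τ ^ 2 * dualEntry x i ^ 2 := by
    intro i
    split_ifs with h0
    · rw [integral_apply_stdGaussian i (f := fun a => (a - τ * dualEntry x i) ^ 2) (by fun_prop)]
      have i1 : Integrable (fun a : ℝ => a ^ 2) (gaussianReal 0 1) :=
        (memLp_id_gaussianReal 2).integrable_sq
      have i2 : Integrable (fun a : ℝ => (2 * τ * dualEntry x i) * a) (gaussianReal 0 1) :=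
        integrable_id_gaussianReal.const_mul _
      have i3 : Integrable (fun a : ℝ => a ^ 2 - (2 * τ * dualEntry x i) * a)
          (gaussianReal 0 1) := i1.sub i2
      have e : ∀ a : ℝ, (a - τ * dualEntry x i) ^ 2
          = a ^ 2 - (2 * τ * dualEntry x i) * a + (τ * dualEntry x i) ^ 2 := fun a => by ring
      simp_rw [e]
      rw [integral_add i3 (integrable_const _), integral_sub i1 i2, integral_const_mul,
        integral_sq_gaussianReal, integral_id_gaussianReal]
      simp
      ring
    · rw [not_not] at h0
      rw [integral_apply_stdGaussian i (f := fun a => excess τ a ^ 2)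
        ((lipschitz_excess_right τ).continuous.pow 2), dualEntry_of_eq_zero h0, meanSqExcess]
      ring
  simp only [distSq]
  rw [integral_finsetSum _ hi]
  simp_rw [he]
  rw [Finset.sum_add_distrib, ← Finset.mul_sum, sum_ite_support hs, sum_dualEntry_sq hx hs,
    meanDistSq]
  ring

lemma integral_distSlope {x : Sig n} {s : ℕ} (hx : ‖x‖ = 1) (hs : nnzEntries x = s) (τ : ℝ) :
    ∫ g, distSlope x τ g ∂(stdGaussian (Sig n)) = meanDistSlope n s (l1 x) τ := by
  have hm : ∀ i, MemLp (fun g : Sig n => excess τ (g i)) 2 (stdGaussian (Sig n)) := fun i =>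
    (memLp_excess τ).comp_measurePreserving (measurePreserving_apply_stdGaussian i)
  have hi : ∀ i ∈ Finset.univ, Integrable (fun g : Sig n => if x i ≠ 0 then
      dualEntry x i * (τ * dualEntry x i - g i) else -excess τ (g i)) (stdGaussian (Sig n)) := by
    intro i _
    split_ifs
    · exact ((integrable_const _).sub
        ((memLp_apply_stdGaussian i).integrable (by norm_num))).const_mul _
    · exact ((hm i).integrable (by norm_num)).neg
  have he : ∀ i, ∫ g : Sig n, (if x i ≠ 0 then
      dualEntry x i * (τ * dualEntry x i - g i) else -excess τ (g i)) ∂(stdGaussian (Sig n))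
      = (if x i ≠ 0 then 0 else -meanExcess τ) + τ * dualEntry x i ^ 2 := by
    intro i
    split_ifs with h0
    · rw [integral_apply_stdGaussian i
        (f := fun a => dualEntry x i * (τ * dualEntry x i - a)) (by fun_prop),
        integral_const_mul, integral_sub (integrable_const _) integrable_id_gaussianReal,
        integral_id_gaussianReal]
      simp
      ring
    · rw [not_not] at h0
      rw [integral_apply_stdGaussian i (f := fun a => -excess τ a)
        (lipschitz_excess_right τ).continuous.neg, dualEntry_of_eq_zero h0, meanExcess,
        integral_neg]
      ring
  simp only [distSlope]
  rw [integral_finsetSum _ hi]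
  simp_rw [he]
  rw [Finset.sum_add_distrib, ← Finset.mul_sum, sum_ite_support hs, sum_dualEntry_sq hx hs,
    meanDistSlope]
  ring

lemma zetaHatPO_l1_eq {x : Sig n} {s : ℕ} (hx : ‖x‖ = 1) (hs : nnzEntries x = s) :
    zetaHatPO x l1 = ⨅ τ : ℝ≥0, meanDistSq n s (l1 x) τ := by
  rw [zetaHatPO]
  refine iInf_congr fun τ => ?_
  rw [← integral_distSq hx hs]
  refine integral_congr_ae (Filter.Eventually.of_forall fun g => ?_)
  exact infDist_sq_eq hx τ.2 g

lemma mul_psi_eq {s : ℕ} (hs : 0 < s) (hsn : s ≤ n) (L : ℝ) :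
    n * psi ((s : ℝ) / n) (L ^ 2 / s) = ⨅ τ : ℝ≥0, meanDistSq n s L τ := by
  have hs' : (s : ℝ) ≠ 0 := by positivity
  have hn' : (n : ℝ) ≠ 0 := by
    have : 0 < n := hs.trans_le hsn
    positivity
  rw [psi, Real.mul_iInf_of_nonneg (by positivity)]
  refine iInf_congr fun τ => ?_
  rw [meanDistSq, meanSqExcess_eq (NNReal.coe_nonneg τ)]
  field_simp
  ring

/-! ### Optimal dilation levels -/

/-- A continuous slope that grows at least linearly has a level at which the first-order
conditions for a minimum over `[0, ∞)` hold. -/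
lemma exists_level {f : ℝ → ℝ} (hf : Continuous f) {β : ℝ} (hβ : 0 < β)
    (h : ∀ τ, 0 ≤ τ → τ * β + f 0 ≤ f τ) : ∃ τ, 0 ≤ τ ∧ 0 ≤ f τ ∧ τ * f τ = 0 := by
  rcases le_or_gt 0 (f 0) with h0 | h0
  · exact ⟨0, le_rfl, h0, zero_mul _⟩
  · have hT : 0 ≤ -f 0 / β := div_nonneg (by linarith) hβ.le
    have h1 : 0 ≤ f (-f 0 / β) := by
      have := h _ hT
      rw [div_mul_cancel₀ _ hβ.ne'] at this
      linarith
    obtain ⟨τ, hτ, hfτ⟩ := intermediate_value_Icc hT hf.continuousOn ⟨h0.le, h1⟩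
    exact ⟨τ, hτ.1, hfτ.ge, by rw [hfτ, mul_zero]⟩

lemma exists_distSlope_level {x : Sig n} (hx : ‖x‖ = 1) (g : Sig n) :
    ∃ τ, 0 ≤ τ ∧ 0 ≤ distSlope x τ g ∧ τ * distSlope x τ g = 0 := by
  refine exists_level (f := fun τ => distSlope x τ g) ?_ (sum_dualEntry_sq_pos hx) fun τ hτ => ?_
  · refine continuous_finsetSum _ fun i _ => ?_
    split_ifs
    · fun_prop
    · exact (lipschitz_excess_left (g i)).continuous.neg
  · rw [distSlope, distSlope, Finset.mul_sum, ← Finset.sum_add_distrib]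
    refine Finset.sum_le_sum fun i _ => ?_
    split_ifs with h0
    · linarith
    · rw [not_not] at h0
      rw [dualEntry_of_eq_zero h0]
      linarith [excess_antitone (g i) hτ]

lemma exists_meanDistSlope_level {s : ℕ} {L : ℝ} (hsn : s ≤ n)
    (hβ : 0 < s - L ^ 2 * (1 - 2 / Real.pi)) :
    ∃ τ, 0 ≤ τ ∧ 0 ≤ meanDistSlope n s L τ ∧ τ * meanDistSlope n s L τ = 0 ∧
      (s < n → 0 < τ) := by
  have hns : (0 : ℝ) ≤ n - s := sub_nonneg.2 (by exact_mod_cast hsn)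
  obtain ⟨τ, h0, h1, h2⟩ := exists_level (f := meanDistSlope n s L)
    (by unfold meanDistSlope; exact (continuous_id.mul continuous_const).sub
          (continuous_const.mul continuous_meanExcess)) hβ fun τ hτ => by
      have := mul_le_mul_of_nonneg_left (meanExcess_antitone hτ) hns
      simp only [meanDistSlope]
      linarith
  refine ⟨τ, h0, h1, h2, fun hlt => h0.lt_of_ne fun he => ?_⟩
  -- at `τ = 0` the slope is a negative multiple of `E|g|`
  have hlt' : (0 : ℝ) < n - s := sub_pos.2 (by exact_mod_cast hlt)
  rw [← he, meanDistSlope, meanExcess_zero] at h1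
  have : 0 < (n - s : ℝ) * √(2 / Real.pi) := by positivity
  linarith

lemma meanSqExcess_tangent (σ τ : ℝ) :
    meanSqExcess τ - 2 * (σ - τ) * meanExcess τ ≤ meanSqExcess σ := by
  have i1 := (memLp_excess τ).integrable_sq
  have i2 := (integrable_excess τ).const_mul (2 * (σ - τ))
  rw [meanSqExcess, meanSqExcess, meanExcess, ← integral_const_mul, ← integral_sub i1 i2]
  refine integral_mono (i1.sub i2) (memLp_excess σ).integrable_sq fun a => ?_
  have := excess_sq_tangent σ τ a
  simp only
  linarith

lemma meanDistSq_tangent {s : ℕ} {L : ℝ} (hsn : s ≤ n)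
    (hβ : 0 ≤ s - L ^ 2 * (1 - 2 / Real.pi)) (σ τ : ℝ) :
    meanDistSq n s L τ + 2 * (σ - τ) * meanDistSlope n s L τ ≤ meanDistSq n s L σ := by
  have hns : (0 : ℝ) ≤ n - s := sub_nonneg.2 (by exact_mod_cast hsn)
  have h1 := mul_le_mul_of_nonneg_left (meanSqExcess_tangent σ τ) hns
  have h2 := mul_nonneg hβ (sq_nonneg (σ - τ))
  rw [meanDistSq, meanDistSq, meanDistSlope]
  nlinarith

lemma meanDistSq_nonneg {s : ℕ} {L : ℝ} (hsn : s ≤ n)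
    (hβ : 0 ≤ s - L ^ 2 * (1 - 2 / Real.pi)) (τ : ℝ) : 0 ≤ meanDistSq n s L τ := by
  have hns : (0 : ℝ) ≤ n - s := sub_nonneg.2 (by exact_mod_cast hsn)
  have : 0 ≤ meanSqExcess τ := integral_nonneg fun _ => sq_nonneg _
  rw [meanDistSq]
  positivity

lemma bddBelow_meanDistSq {s : ℕ} {L : ℝ} (hsn : s ≤ n)
    (hβ : 0 ≤ s - L ^ 2 * (1 - 2 / Real.pi)) :
    BddBelow (range fun τ : ℝ≥0 => meanDistSq n s L τ) :=
  ⟨0, by rintro _ ⟨τ, rfl⟩; exact meanDistSq_nonneg hsn hβ τ⟩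

lemma iInf_meanDistSq_eq {s : ℕ} {L : ℝ} (hsn : s ≤ n)
    (hβ : 0 ≤ s - L ^ 2 * (1 - 2 / Real.pi)) {τ : ℝ} (h0 : 0 ≤ τ)
    (h1 : 0 ≤ meanDistSlope n s L τ) (h2 : τ * meanDistSlope n s L τ = 0) :
    ⨅ σ : ℝ≥0, meanDistSq n s L σ = meanDistSq n s L τ := by
  refine le_antisymm (ciInf_le (bddBelow_meanDistSq hsn hβ) ⟨τ, h0⟩) (le_ciInf fun σ => ?_)
  have := meanDistSq_tangent hsn hβ σ τ
  have h3 := mul_nonneg σ.2 h1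
  simp only [NNReal.val_eq_coe] at h3
  nlinarith

/-! ### Projection onto the cone generated by the preimage of the subdifferential -/

/-- If `τ` satisfies the first-order conditions for `g`, then `dualProj x τ g` is the projection
of `g` onto the cone generated by `Q_x⁻¹ ∂‖·‖₁(x)`: the residual is in the polar cone. -/
lemma inner_sub_dualProj_nonpos {x : Sig n} (hx : ‖x‖ = 1) {g : Sig n} {τ : ℝ} (h0 : 0 ≤ τ)
    (h1 : 0 ≤ distSlope x τ g) {σ : ℝ} (hσ : 0 ≤ σ) {q : Sig n}
    (hq : q ∈ σ • (Q x ⁻¹' subdiff l1 x)) : ⟪q, g - dualProj x τ g⟫ ≤ 0 := by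
  have h : ⟪q, g - dualProj x τ g⟫ ≤ -(σ * distSlope x τ g) := by
    rw [PiLp.inner_apply, distSlope, Finset.mul_sum, ← Finset.sum_neg_distrib]
    refine Finset.sum_le_sum fun i _ => ?_
    have hi := (mem_smul_preimage_Q_subdiff hx hσ).1 hq i
    simp only [PiLp.sub_apply, RCLike.inner_apply, conj_trivial, dualProj]
    split_ifs at hi ⊢
    · rw [hi]; linarith
    · calc (g i - clip τ (g i)) * q i ≤ |(g i - clip τ (g i)) * q i| := le_abs_self _
        _ = excess τ (g i) * |q i| := by rw [abs_mul, abs_sub_clip h0]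
        _ ≤ excess τ (g i) * σ := mul_le_mul_of_nonneg_left hi (excess_nonneg _ _)
        _ = _ := by ring
  linarith [mul_nonneg hσ h1]

lemma inner_dualProj_sub_eq_zero {x g : Sig n} {τ : ℝ} (h0 : 0 ≤ τ)
    (h2 : τ * distSlope x τ g = 0) : ⟪dualProj x τ g, g - dualProj x τ g⟫ = 0 := by
  have h : ⟪dualProj x τ g, g - dualProj x τ g⟫ = -(τ * distSlope x τ g) := by
    rw [PiLp.inner_apply, distSlope, Finset.mul_sum, ← Finset.sum_neg_distrib]
    refine Finset.sum_congr rfl fun i _ => ?_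
    simp only [PiLp.sub_apply, RCLike.inner_apply, conj_trivial, dualProj]
    split_ifs
    · ring
    · rw [mul_comm, clip_mul_sub_clip h0]; ring
  rw [h, h2, neg_zero]

lemma inner_dualProj (x : Sig n) (hx : ‖x‖ = 1) (τ : ℝ) (g : Sig n) :
    ⟪x, dualProj x τ g⟫ = τ * (√(2 / Real.pi) * l1 x) := by
  have h : ⟪x, dualProj x τ g⟫
      = ∑ i, (τ * |x i| - τ * (1 - √(2 / Real.pi)) * l1 x * x i ^ 2) := by
    rw [PiLp.inner_apply]
    refine Finset.sum_congr rfl fun i _ => ?_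
    simp only [RCLike.inner_apply, conj_trivial, dualProj]
    split_ifs with h0
    · rw [← sign_mul_self (x i), dualEntry]; ring
    · rw [not_not] at h0
      simp [h0]
  rw [h, Finset.sum_sub_distrib, ← Finset.mul_sum, ← Finset.mul_sum, sum_sq_eq_one hx, ← l1]
  ring

lemma norm_sub_le_of_variational {p q g h : Sig n} (h1 : ⟪q, g - p⟫ ≤ 0) (h2 : ⟪p, g - p⟫ = 0)
    (h3 : ⟪p, h - q⟫ ≤ 0) (h4 : ⟪q, h - q⟫ = 0) : ‖p - q‖ ≤ ‖g - h‖ := by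
  have e : ⟪p - q, p - q⟫ ≤ ⟪p - q, g - h⟫ := by
    simp only [inner_sub_left, inner_sub_right] at *
    linarith
  have c := real_inner_le_norm (p - q) (g - h)
  rw [real_inner_self_eq_norm_sq] at e
  rcases (norm_nonneg (p - q)).eq_or_lt with h0 | h0
  · rw [← h0]; exact norm_nonneg _
  · nlinarith

lemma sqrt_pi_div_two_mul : √(Real.pi / 2) * √(2 / Real.pi) = 1 := by
  rw [← Real.sqrt_mul (by positivity), show Real.pi / 2 * (2 / Real.pi) = 1 by field_simp,
    Real.sqrt_one]

/-- The level of the projection onto the dual cone is a Lipschitz function of the point: it is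
read off the projection as a multiple of the inner product with `x`. -/
lemma lipschitz_level {x : Sig n} (hx : ‖x‖ = 1) {T : Sig n → ℝ} (h0 : ∀ g, 0 ≤ T g)
    (h1 : ∀ g, 0 ≤ distSlope x (T g) g) (h2 : ∀ g, T g * distSlope x (T g) g = 0) :
    LipschitzWith (√(Real.pi / 2) / l1 x).toNNReal T := by
  have hL := l1_pos hx
  refine LipschitzWith.of_dist_le_mul fun g h => ?_
  rw [Real.coe_toNNReal _ (by positivity)]
  set p := dualProj x (T g) g with hp
  set q := dualProj x (T h) h with hq
  have hpq : ‖p - q‖ ≤ ‖g - h‖ := norm_sub_le_of_variational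
    (inner_sub_dualProj_nonpos hx (h0 g) (h1 g) (h0 h) (dualProj_mem hx (h0 h) h))
    (inner_dualProj_sub_eq_zero (h0 g) (h2 g))
    (inner_sub_dualProj_nonpos hx (h0 h) (h1 h) (h0 g) (dualProj_mem hx (h0 g) g))
    (inner_dualProj_sub_eq_zero (h0 h) (h2 h))
  have e : T g - T h = √(Real.pi / 2) / l1 x * ⟪x, p - q⟫ := by
    rw [inner_sub_right, inner_dualProj x hx, inner_dualProj x hx]
    field_simp
    linear_combination -(T g - T h) * sqrt_pi_div_two_mul
  rw [Real.dist_eq, dist_eq_norm, e, abs_mul, abs_of_nonneg (by positivity)]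
  refine mul_le_mul_of_nonneg_left ?_ (by positivity)
  calc |⟪x, p - q⟫| ≤ ‖x‖ * ‖p - q‖ := abs_real_inner_le_norm _ _
    _ = ‖p - q‖ := by rw [hx, one_mul]
    _ ≤ ‖g - h‖ := hpq

lemma lipschitz_distSlope {x : Sig n} (hx : ‖x‖ = 1) (τ : ℝ) :
    LipschitzWith (√(n : ℝ)).toNNReal (distSlope x τ) := by
  refine LipschitzWith.of_dist_le_mul fun g h => ?_
  rw [Real.coe_toNNReal _ (Real.sqrt_nonneg _), Real.dist_eq, distSlope, distSlope,
    ← Finset.sum_sub_distrib]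
  set c : Fin n → ℝ := fun i => if x i ≠ 0 then |dualEntry x i| else 1 with hc
  have hterm : ∀ i ∈ Finset.univ,
      |(if x i ≠ 0 then dualEntry x i * (τ * dualEntry x i - g i) else -excess τ (g i))
        - (if x i ≠ 0 then dualEntry x i * (τ * dualEntry x i - h i) else -excess τ (h i))|
      ≤ c i * |(g - h) i| := by
    intro i _
    simp only [hc, PiLp.sub_apply]
    split_ifs
    · rw [← abs_mul, ← abs_neg]
      apply le_of_eq
      congr 1
      ring
    · have := (lipschitz_excess_right τ).dist_le_mul (g i) (h i)
      rw [Real.dist_eq, Real.dist_eq, NNReal.coe_one] at this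
      rw [← abs_neg]
      convert this using 2
      ring
  have hcs : ∑ i, c i ^ 2 ≤ n := by
    have e : ∀ i, c i ^ 2 = (if x i ≠ 0 then 0 else 1) + dualEntry x i ^ 2 := by
      intro i
      simp only [hc]
      split_ifs with h0
      · rw [sq_abs, zero_add]
      · rw [not_not] at h0
        simp [dualEntry_of_eq_zero h0]
    simp_rw [e]
    rw [Finset.sum_add_distrib, sum_ite_support rfl, sum_dualEntry_sq hx rfl]
    have h4 : 2 / Real.pi ≤ 1 := (div_le_one Real.pi_pos).2 Real.two_le_pi
    nlinarith [mul_nonneg (sq_nonneg (l1 x)) (sub_nonneg.2 h4)]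
  calc _ ≤ ∑ i, c i * |(g - h) i| :=
        (Finset.abs_sum_le_sum_abs _ _).trans (Finset.sum_le_sum hterm)
    _ ≤ √(∑ i, c i ^ 2) * √(∑ i, |(g - h) i| ^ 2) := Real.sum_mul_le_sqrt_mul_sqrt _ _ _
    _ ≤ √(n : ℝ) * dist g h := by
      rw [EuclideanSpace.dist_eq]
      refine mul_le_mul (Real.sqrt_le_sqrt hcs) (le_of_eq ?_) (by positivity) (by positivity)
      simp [Real.dist_eq]

lemma abs_covariance_le {Ω : Type*} [MeasurableSpace Ω] {μ : Measure Ω} [IsProbabilityMeasure μ]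
    {X Y : Ω → ℝ} (hX : MemLp X 2 μ) (hY : MemLp Y 2 μ) {a b : ℝ} (ha : 0 < a)
    (hb : 0 < b) (h1 : Var[X; μ] ≤ a ^ 2) (h2 : Var[Y; μ] ≤ b ^ 2) : |cov[X, Y; μ]| ≤ a * b := by
  have hp := variance_nonneg (fun ω => b * X ω + a * Y ω) μ
  have hm := variance_nonneg (fun ω => b * X ω - a * Y ω) μ
  rw [variance_fun_add (hX.const_mul b) (hY.const_mul a)] at hp
  rw [variance_fun_sub (hX.const_mul b) (hY.const_mul a)] at hm
  simp only [variance_const_mul, covariance_const_mul_left, covariance_const_mul_right] at hp hm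
  have hab := mul_pos ha hb
  have k1 := mul_le_mul_of_nonneg_left h1 (sq_nonneg b)
  have k2 := mul_le_mul_of_nonneg_left h2 (sq_nonneg a)
  rw [abs_le]
  constructor <;> nlinarith

/-- The mean of the squared distance to the whole dual cone falls short of the surrogate by at most
`√(2πn) / ‖x‖₁`. The tangent inequality at the level `τ` that is optimal on average, evaluated at
the optimal level `T g` for `g`, reduces this to the covariance of `T` with the slope, which
the Poincaré inequality controls. -/
lemma le_integral_distSq_level {x : Sig n} {s : ℕ} (hx : ‖x‖ = 1) (hs : nnzEntries x = s)
    {T : Sig n → ℝ} (h0 : ∀ g, 0 ≤ T g)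
    (h1 : ∀ g, 0 ≤ distSlope x (T g) g) (h2 : ∀ g, T g * distSlope x (T g) g = 0)
    (hi : Integrable (fun g => distSq x (T g) g) (stdGaussian (Sig n))) :
    (⨅ τ : ℝ≥0, meanDistSq n s (l1 x) τ) - √(2 * Real.pi * n) / l1 x
      ≤ ∫ g, distSq x (T g) g ∂(stdGaussian (Sig n)) := by
  have hL := l1_pos hx
  have hsn := support_le hs
  have hn : 0 < (n : ℝ) := by
    exact_mod_cast (support_pos hx hs).trans_le hsn
  have hβ : 0 < s - l1 x ^ 2 * (1 - 2 / Real.pi) := by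
    rw [← sum_dualEntry_sq hx hs]; exact sum_dualEntry_sq_pos hx
  obtain ⟨τ, t0, t1, t2, -⟩ := exists_meanDistSlope_level hsn hβ
  rw [iInf_meanDistSq_eq hsn hβ.le t0 t1 t2]
  have lT := lipschitz_level hx h0 h1 h2
  have lD := lipschitz_distSlope hx τ
  have mT : MemLp T 2 (stdGaussian (Sig n)) := memLp_two_of_lipschitz lT
  have mD : MemLp (distSlope x τ) 2 (stdGaussian (Sig n)) := memLp_two_of_lipschitz lD
  have hcov := abs_covariance_le mT mD (a := √(Real.pi / 2) / l1 x) (b := √(n : ℝ))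
    (by positivity) (by positivity)
    (by simpa only [Real.coe_toNNReal _ (show 0 ≤ √(Real.pi / 2) / l1 x by positivity)]
          using variance_stdGaussian_le lT)
    (by simpa only [Real.coe_toNNReal _ (Real.sqrt_nonneg _)] using variance_stdGaussian_le lD)
  have hcov' := (abs_le.1 hcov).1
  rw [covariance_eq_sub mT mD, integral_distSlope hx hs] at hcov'
  have iT : Integrable T (stdGaussian (Sig n)) := mT.integrable (by norm_num)
  have iD : Integrable (distSlope x τ) (stdGaussian (Sig n)) := mD.integrable (by norm_num)
  have iTD : Integrable (fun g => T g * distSlope x τ g) (stdGaussian (Sig n)) :=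
    mT.integrable_mul mD
  have iS : Integrable (distSq x τ) (stdGaussian (Sig n)) :=
    (integrable_infDist_sq (τ • (Q x ⁻¹' subdiff l1 x))).congr
      (Filter.Eventually.of_forall fun g => infDist_sq_eq hx t0 g)
  have iR : Integrable (fun g => 2 * (T g * distSlope x τ g) - 2 * τ * distSlope x τ g)
      (stdGaussian (Sig n)) := (iTD.const_mul 2).sub (iD.const_mul _)
  have hmono : ∫ g, (distSq x τ g + (2 * (T g * distSlope x τ g) - 2 * τ * distSlope x τ g))
      ∂(stdGaussian (Sig n)) ≤ ∫ g, distSq x (T g) g ∂(stdGaussian (Sig n)) := by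
    refine integral_mono (iS.add iR) hi fun g => ?_
    have := distSq_tangent x (T g) τ g
    simp only
    linarith
  rw [integral_add iS iR, integral_sub (iTD.const_mul 2) (iD.const_mul _), integral_const_mul,
    integral_const_mul, integral_distSq hx hs, integral_distSlope hx hs] at hmono
  have hET : 0 ≤ ∫ g, T g ∂(stdGaussian (Sig n)) := integral_nonneg h0
  have hc : √(2 * Real.pi * n) / l1 x = 2 * (√(Real.pi / 2) / l1 x * √(n : ℝ)) := by
    rw [show 2 * Real.pi * n = 2 ^ 2 * (Real.pi / 2 * n) by ring,
      Real.sqrt_mul (by positivity), Real.sqrt_sq (by norm_num), Real.sqrt_mul (by positivity)]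
    ring
  have hpos := mul_nonneg hET t1
  simp only [Pi.mul_apply] at hcov'
  rw [hc]
  linarith

/-! ### Descent directions and Gaussian widths -/

lemma inner_Q_left (x u v : Sig n) : ⟪Q x u, v⟫ = ⟪u, Q x v⟫ := by
  rw [Q_apply, Q_apply, inner_add_left, inner_add_right, inner_smul_left, inner_smul_right,
    real_inner_comm u x]
  simp only [conj_trivial]
  ring

lemma Q_self {x : Sig n} (hx : ‖x‖ = 1) : Q x x = √(Real.pi / 2) • x := by
  rw [Q_apply, real_inner_self_eq_norm_sq, hx]
  module

lemma inner_nonpos_of_mem_descentCone {f : Sig n → ℝ} {x w u : Sig n} (hw : w ∈ subdiff f x)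
    (hu : u ∈ descentCone f x) : ⟪w, u⟫ ≤ 0 := by
  obtain ⟨t, ht, h⟩ := hu
  have h1 := hw (x + t • u)
  rw [add_sub_cancel_left, inner_smul_right] at h1
  exact nonpos_of_mul_nonpos_right (by linarith) ht

/-- The directions in the polar cone of `∂‖·‖₁(x)` are descent directions: near `x` the `ℓ₁` norm
agrees along a ray with the linear function given by a suitable subgradient. -/
lemma mem_descentCone_l1 {x u : Sig n} (h : ∀ w ∈ subdiff l1 x, ⟪w, u⟫ ≤ 0) :
    u ∈ descentCone l1 x := by
  have hev : ∀ᶠ t in nhdsWithin (0 : ℝ) (Ioi 0), ∀ i, x i ≠ 0 → t * |u i| ≤ |x i| := by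
    rw [Filter.eventually_all]
    intro i
    by_cases hi : x i = 0
    · simp [hi]
    · have hc : Filter.Tendsto (fun t : ℝ => t * |u i|) (nhdsWithin 0 (Ioi 0)) (nhds 0) := by
        have : Filter.Tendsto (fun t : ℝ => t * |u i|) (nhds 0) (nhds (0 * |u i|)) :=
          (continuous_id.mul continuous_const).tendsto 0
        rw [zero_mul] at this
        exact this.mono_left nhdsWithin_le_nhds
      filter_upwards [hc.eventually_le_const (abs_pos.2 hi)] with t ht _ using ht
  obtain ⟨t, ht, ht0⟩ := (hev.and self_mem_nhdsWithin).exists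
  have ht0' : 0 < t := ht0
  set w : Sig n := WithLp.toLp 2 fun i =>
    if x i ≠ 0 then (SignType.sign (x i) : ℝ) else SignType.sign (u i) with hw
  have hwm : w ∈ subdiff l1 x := by
    refine mem_subdiff_l1.2 fun i => ?_
    simp only [hw]
    split_ifs
    · rfl
    · exact abs_sign_le_one _
  refine ⟨t, ht0', ?_⟩
  have e : l1 (x + t • u) = l1 x + t * ⟪w, u⟫ := by
    rw [l1, l1, PiLp.inner_apply, Finset.mul_sum, ← Finset.sum_add_distrib]
    refine Finset.sum_congr rfl fun i _ => ?_
    simp only [PiLp.add_apply, PiLp.smul_apply, smul_eq_mul, RCLike.inner_apply, conj_trivial, hw]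
    split_ifs with h0
    · have hti := ht i h0
      have h1 := neg_abs_le (t * u i)
      have h2 := le_abs_self (t * u i)
      rw [abs_mul, abs_of_pos ht0'] at h1 h2
      rcases lt_or_gt_of_ne h0 with hn | hp
      · rw [abs_of_neg hn] at hti ⊢
        rw [sign_neg hn, abs_of_nonpos (by linarith)]
        simp
        ring
      · rw [abs_of_pos hp] at hti ⊢
        rw [sign_pos hp, abs_of_nonneg (by linarith)]
        simp
    · rw [not_not] at h0
      rw [h0, zero_add, abs_mul, abs_of_pos ht0', ← sign_mul_self (u i)]
      simp
  rw [e]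
  linarith [mul_nonpos_of_nonneg_of_nonpos ht0'.le (h w hwm)]

/-- The descent directions `u` with `‖Q_x u‖ = 1`. -/
def unitDescent (x : Sig n) : Set (Sig n) := {u | u ∈ descentCone l1 x ∧ ‖Q x u‖ = 1}

lemma unitDescent_nonempty {x : Sig n} (hx : ‖x‖ = 1) : (unitDescent x).Nonempty := by
  have hp : 0 < √(Real.pi / 2) := by positivity
  refine ⟨-(√(Real.pi / 2))⁻¹ • x, ⟨√(Real.pi / 2), hp, ?_⟩, ?_⟩
  · rw [smul_smul, mul_neg, mul_inv_cancel₀ hp.ne', neg_one_smul, add_neg_cancel]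
    simpa [l1] using (l1_pos hx).le
  · rw [map_smul, Q_self hx, smul_smul, neg_mul, inv_mul_cancel₀ hp.ne', neg_one_smul, norm_neg, hx]

lemma inner_Q_le_infDist {x : Sig n} (hx : ‖x‖ = 1) {u : Sig n} (hu : u ∈ unitDescent x) {τ : ℝ}
    (hτ : 0 ≤ τ) (g : Sig n) : ⟪g, Q x u⟫ ≤ Metric.infDist g (τ • (Q x ⁻¹' subdiff l1 x)) := by
  refine (Metric.le_infDist ⟨_, dualProj_mem hx hτ g⟩).2 ?_
  rintro _ ⟨q, hq, rfl⟩
  have h1 : ⟪q, Q x u⟫ ≤ 0 := by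
    rw [← inner_Q_left]
    exact inner_nonpos_of_mem_descentCone hq hu.1
  have h2 := real_inner_le_norm (g - τ • q) (Q x u)
  rw [hu.2, mul_one, inner_sub_left, inner_smul_left, conj_trivial] at h2
  rw [dist_eq_norm]
  linarith [mul_nonpos_of_nonneg_of_nonpos hτ h1]

/-- The supremum of `⟪g, Q_x u⟫` over the descent directions `u` with `‖Q_x u‖ = 1`, without the
projection of `g` that `coneSup` has. -/
noncomputable def fullSup (x g : Sig n) : ℝ := sSup ((fun u => ⟪g, Q x u⟫) '' unitDescent x)

lemma bddAbove_fullSup (x g : Sig n) : BddAbove ((fun u => ⟪g, Q x u⟫) '' unitDescent x) := by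
  refine ⟨‖g‖, ?_⟩
  rintro _ ⟨u, hu, rfl⟩
  have := real_inner_le_norm g (Q x u)
  rwa [hu.2, mul_one] at this

lemma inner_Q_le_fullSup {x u : Sig n} (hu : u ∈ unitDescent x) (g : Sig n) :
    ⟪g, Q x u⟫ ≤ fullSup x g :=
  le_csSup (bddAbove_fullSup x g) ⟨u, hu, rfl⟩

lemma fullSup_le {x : Sig n} (hx : ‖x‖ = 1) {g : Sig n} {a : ℝ}
    (h : ∀ u ∈ unitDescent x, ⟪g, Q x u⟫ ≤ a) : fullSup x g ≤ a := by
  refine csSup_le ((unitDescent_nonempty hx).image _) ?_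
  rintro _ ⟨u, hu, rfl⟩
  exact h u hu

lemma lipschitz_fullSup {x : Sig n} (hx : ‖x‖ = 1) : LipschitzWith 1 (fullSup x) := by
  refine LipschitzWith.of_le_add fun g h => fullSup_le hx fun u hu => ?_
  have h1 := inner_Q_le_fullSup hu h
  have h2 := real_inner_le_norm (g - h) (Q x u)
  rw [hu.2, mul_one, inner_sub_left, ← dist_eq_norm] at h2
  linarith

lemma fullSup_le_infDist {x : Sig n} (hx : ‖x‖ = 1) {τ : ℝ} (hτ : 0 ≤ τ) (g : Sig n) :
    fullSup x g ≤ Metric.infDist g (τ • (Q x ⁻¹' subdiff l1 x)) :=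
  fullSup_le hx fun _ hu => inner_Q_le_infDist hx hu hτ g

/-- The normalized residual of the projection of `g` onto the dual cone is a descent direction (up
to `Q_x`), so that `fullSup` dominates the distance of `g` to the dual cone. -/
lemma distSq_level_le_fullSup_sq {x : Sig n} (hx : ‖x‖ = 1) {g : Sig n} {τ : ℝ} (h0 : 0 ≤ τ)
    (h1 : 0 ≤ distSlope x τ g) (h2 : τ * distSlope x τ g = 0) :
    distSq x τ g ≤ fullSup x g ^ 2 := by
  set r := g - dualProj x τ g with hr
  rw [← norm_sq_sub_dualProj x h0, ← hr]
  rcases (norm_nonneg r).eq_or_lt with hz | hpos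
  · rw [← hz, zero_pow two_ne_zero]; exact sq_nonneg _
  obtain ⟨u, hu⟩ : ∃ u, Q x u = ‖r‖⁻¹ • r := by
    have h := preimage_Q x hx {‖r‖⁻¹ • r}
    rw [image_singleton] at h
    exact ⟨_, h.symm.subset rfl⟩
  have hmem : u ∈ unitDescent x := by
    refine ⟨mem_descentCone_l1 fun w hw => ?_, ?_⟩
    · -- `w = Q_x q` with `q` in `Q_x⁻¹ ∂‖·‖₁(x)`, with which the residual has non-positive inner product
      obtain ⟨q, hq⟩ : ∃ q, Q x q = w := by
        have h := preimage_Q x hx {w}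
        rw [image_singleton] at h
        exact ⟨_, h.symm.subset rfl⟩
      have hqm : q ∈ (1 : ℝ) • (Q x ⁻¹' subdiff l1 x) := by
        rw [one_smul, mem_preimage, hq]; exact hw
      have := inner_sub_dualProj_nonpos hx h0 h1 zero_le_one hqm
      rw [← hq, inner_Q_left, hu, inner_smul_right]
      exact mul_nonpos_of_nonneg_of_nonpos (inv_nonneg.2 hpos.le) this
    · rw [hu, norm_smul, norm_inv, norm_norm, inv_mul_cancel₀ hpos.ne']
  have hle : ‖r‖ ≤ fullSup x g := by
    refine le_trans (le_of_eq ?_) (inner_Q_le_fullSup hmem g)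
    have hgr : ⟪g, r⟫ = ‖r‖ ^ 2 := by
      rw [← real_inner_self_eq_norm_sq]
      have := inner_dualProj_sub_eq_zero (x := x) (g := g) h0 h2
      rw [← hr] at this
      conv_lhs => rw [show g = dualProj x τ g + r by rw [hr]; abel]
      rw [inner_add_left, this, zero_add]
    rw [hu, inner_smul_right, hgr]
    field_simp
  exact pow_le_pow_left₀ hpos.le hle 2

lemma inner_projPerp_self {x : Sig n} (hx : ‖x‖ = 1) (g : Sig n) : ⟪projPerp x g, x⟫ = 0 := by
  rw [projPerp, inner_sub_left, inner_smul_left, real_inner_self_eq_norm_sq, hx,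
    real_inner_comm]
  simp

lemma inner_projPerp_Q {x : Sig n} (hx : ‖x‖ = 1) (g u : Sig n) :
    ⟪projPerp x g, Q x u⟫ = ⟪projPerp x g, u⟫ := by
  rw [Q_apply, inner_add_right, inner_smul_right, inner_projPerp_self hx, mul_zero, add_zero]

lemma inner_projPerp_le_coneSup {x : Sig n} (hx : ‖x‖ = 1) {u : Sig n} (hu : u ∈ unitDescent x)
    (g : Sig n) : ⟪projPerp x g, u⟫ ≤ coneSup l1 x g :=
  le_csSup (bddAbove_coneSup l1 x hx g) ⟨u, hu, rfl⟩

lemma fullSup_sub_le_coneSup {x : Sig n} (hx : ‖x‖ = 1) (g : Sig n) :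
    fullSup x g - |⟪x, g⟫| ≤ coneSup l1 x g := by
  rw [sub_le_iff_le_add]
  refine fullSup_le hx fun u hu => ?_
  have h1 := inner_projPerp_le_coneSup hx hu g
  rw [← inner_projPerp_Q hx, projPerp, inner_sub_left, inner_smul_left, conj_trivial] at h1
  have h2 : ⟪x, g⟫ * ⟪x, Q x u⟫ ≤ |⟪x, g⟫| := by
    have h3 := abs_real_inner_le_norm x (Q x u)
    rw [hx, hu.2, one_mul] at h3
    calc ⟪x, g⟫ * ⟪x, Q x u⟫ ≤ |⟪x, g⟫ * ⟪x, Q x u⟫| := le_abs_self _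
      _ = |⟪x, g⟫| * |⟪x, Q x u⟫| := abs_mul _ _
      _ ≤ |⟪x, g⟫| * 1 := by gcongr
      _ = |⟪x, g⟫| := mul_one _
  linarith

/-- The projection `I - x xᵀ` is the mean of the identity and the reflection in `xᗮ`, so
`coneSup` is at most the mean of the distances of `g` and of its reflection. -/
lemma coneSup_le_infDist {x : Sig n} (hx : ‖x‖ = 1) {τ : ℝ} (hτ : 0 ≤ τ) (g : Sig n) :
    coneSup l1 x g ≤ (Metric.infDist g (τ • (Q x ⁻¹' subdiff l1 x))
      + Metric.infDist ((ℝ ∙ x)ᗮ.reflection g) (τ • (Q x ⁻¹' subdiff l1 x))) / 2 := by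
  refine csSup_le ((unitDescent_nonempty hx).image _) ?_
  rintro _ ⟨u, hu, rfl⟩
  have h1 := inner_Q_le_infDist hx hu hτ g
  have h2 := inner_Q_le_infDist hx hu hτ ((ℝ ∙ x)ᗮ.reflection g)
  have e : projPerp x g = (1 / 2 : ℝ) • (g + (ℝ ∙ x)ᗮ.reflection g) := by
    rw [Submodule.reflection_orthogonal_apply, Submodule.reflection_singleton_apply, projPerp, hx]
    simp only [RCLike.ofReal_real_eq_id, id_eq, one_pow, div_one]
    module
  show ⟪projPerp x g, u⟫ ≤ _
  rw [← inner_projPerp_Q hx, e, inner_smul_left, inner_add_left, conj_trivial]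
  linarith

/-! ### The two bounds for the threshold -/

lemma sq_integral_le {Ω : Type*} [MeasurableSpace Ω] {μ : Measure Ω} [IsProbabilityMeasure μ]
    {X : Ω → ℝ} (hX : MemLp X 2 μ) : (∫ ω, X ω ∂μ) ^ 2 ≤ ∫ ω, X ω ^ 2 ∂μ := by
  have h := variance_nonneg X μ
  rw [variance_eq_sub hX] at h
  simp only [Pi.pow_apply] at h
  linarith

lemma memLp_infDist (S : Set (Sig n)) :
    MemLp (fun g => Metric.infDist g S) 2 (stdGaussian (Sig n)) :=
  memLp_two_of_lipschitz (Metric.lipschitz_infDist_pt S)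

lemma integral_infDist_sq {x : Sig n} {s : ℕ} (hx : ‖x‖ = 1) (hs : nnzEntries x = s) {τ : ℝ}
    (hτ : 0 ≤ τ) : ∫ g, Metric.infDist g (τ • (Q x ⁻¹' subdiff l1 x)) ^ 2 ∂(stdGaussian (Sig n))
      = meanDistSq n s (l1 x) τ := by
  rw [← integral_distSq hx hs]
  exact integral_congr_ae (Filter.Eventually.of_forall fun g => infDist_sq_eq hx hτ g)

lemma integral_coneSup_nonneg {x : Sig n} (hx : ‖x‖ = 1) :
    0 ≤ ∫ g, coneSup l1 x g ∂(stdGaussian (Sig n)) := by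
  obtain ⟨u, hu⟩ := unitDescent_nonempty hx
  have hlin : ∀ g, ⟪projPerp x g, u⟫ = innerSL ℝ (projPerp x u) g := by
    intro g
    rw [innerSL_apply_apply, projPerp, projPerp, inner_sub_left, inner_sub_left, inner_smul_left,
      inner_smul_left, real_inner_comm u g]
    simp only [conj_trivial]
    ring
  have h0 : ∫ g, innerSL ℝ (projPerp x u) g ∂(stdGaussian (Sig n)) = 0 :=
    integral_strongDual_stdGaussian _
  rw [← h0]
  refine integral_mono ?_ (integrable_coneSup l1 x hx) fun g => ?_
  · exact (innerSL ℝ (projPerp x u)).integrable_comp IsGaussian.integrable_id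
  · rw [← hlin]
    exact inner_projPerp_le_coneSup hx hu g

lemma integral_fullSup_nonneg {x : Sig n} (hx : ‖x‖ = 1) :
    0 ≤ ∫ g, fullSup x g ∂(stdGaussian (Sig n)) := by
  obtain ⟨u, hu⟩ := unitDescent_nonempty hx
  have h0 : ∫ g, innerSL ℝ (Q x u) g ∂(stdGaussian (Sig n)) = 0 :=
    integral_strongDual_stdGaussian _
  rw [← h0]
  refine integral_mono ((innerSL ℝ (Q x u)).integrable_comp IsGaussian.integrable_id)
    ((memLp_two_of_lipschitz (lipschitz_fullSup hx)).integrable (by norm_num)) fun g => ?_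
  rw [innerSL_apply_apply, real_inner_comm]
  exact inner_Q_le_fullSup hu g

lemma zetaPO_le {x : Sig n} {s : ℕ} (hx : ‖x‖ = 1) (hs : nnzEntries x = s) {τ : ℝ}
    (hτ : 0 ≤ τ) : zetaPO x l1 ≤ meanDistSq n s (l1 x) τ := by
  set d := fun g => Metric.infDist g (τ • (Q x ⁻¹' subdiff l1 x)) with hd
  have hmp : MeasurePreserving (ℝ ∙ x)ᗮ.reflection (stdGaussian (Sig n)) (stdGaussian (Sig n)) :=
    ⟨(ℝ ∙ x)ᗮ.reflection.continuous.measurable, stdGaussian_map (ℝ ∙ x)ᗮ.reflection⟩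
  have hm : MemLp d 2 (stdGaussian (Sig n)) := memLp_infDist _
  have hi : Integrable d (stdGaussian (Sig n)) := hm.integrable (by norm_num)
  have hi' : Integrable (fun g => d ((ℝ ∙ x)ᗮ.reflection g)) (stdGaussian (Sig n)) :=
    hmp.integrable_comp_of_integrable hi
  have hrefl : ∫ g, d ((ℝ ∙ x)ᗮ.reflection g) ∂(stdGaussian (Sig n))
      = ∫ g, d g ∂(stdGaussian (Sig n)) :=
    hmp.integral_comp ((ℝ ∙ x)ᗮ.reflection.toHomeomorph.measurableEmbedding) d
  have hle : ∫ g, coneSup l1 x g ∂(stdGaussian (Sig n)) ≤ ∫ g, d g ∂(stdGaussian (Sig n)) := by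
    have := integral_mono (integrable_coneSup l1 x hx) ((hi.add hi').div_const 2)
      fun g => coneSup_le_infDist hx hτ g
    simp only [Pi.add_apply] at this
    rw [integral_div, integral_add hi hi', hrefl] at this
    linarith
  calc zetaPO x l1 ≤ (∫ g, d g ∂(stdGaussian (Sig n))) ^ 2 :=
        pow_le_pow_left₀ (integral_coneSup_nonneg hx) hle 2
    _ ≤ ∫ g, d g ^ 2 ∂(stdGaussian (Sig n)) := sq_integral_le hm
    _ = meanDistSq n s (l1 x) τ := integral_infDist_sq hx hs hτ

/-- The mean of `fullSup`, from above by the surrogate and from below, by the Poincaré inequality,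
through its second moment. -/
lemma integral_fullSup_bounds {x : Sig n} {s : ℕ} (hx : ‖x‖ = 1) (hs : nnzEntries x = s) :
    ∫ g, fullSup x g ∂(stdGaussian (Sig n)) ≤ √(⨅ τ : ℝ≥0, meanDistSq n s (l1 x) τ) ∧
    (⨅ τ : ℝ≥0, meanDistSq n s (l1 x) τ) - √(2 * Real.pi * n) / l1 x - 1
      ≤ (∫ g, fullSup x g ∂(stdGaussian (Sig n))) ^ 2 := by
  have hsn := support_le hs
  have hβ : 0 < s - l1 x ^ 2 * (1 - 2 / Real.pi) := by
    rw [← sum_dualEntry_sq hx hs]; exact sum_dualEntry_sq_pos hx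
  have hm : MemLp (fullSup x) 2 (stdGaussian (Sig n)) :=
    memLp_two_of_lipschitz (lipschitz_fullSup hx)
  constructor
  · obtain ⟨τ, t0, t1, t2, -⟩ := exists_meanDistSlope_level hsn hβ
    rw [iInf_meanDistSq_eq hsn hβ.le t0 t1 t2, ← integral_infDist_sq hx hs t0]
    have hd := memLp_infDist (τ • (Q x ⁻¹' subdiff l1 x))
    refine (integral_mono (hm.integrable (by norm_num)) (hd.integrable (by norm_num))
      fun g => fullSup_le_infDist hx t0 g).trans ?_
    exact Real.le_sqrt_of_sq_le (sq_integral_le hd)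
  · choose T h0 h1 h2 using exists_distSlope_level hx
    have hle : ∀ g, distSq x (T g) g ≤ fullSup x g ^ 2 := fun g =>
      distSq_level_le_fullSup_sq hx (h0 g) (h1 g) (h2 g)
    have hTc : Continuous T := (lipschitz_level hx h0 h1 h2).continuous
    have hc : Continuous fun g => distSq x (T g) g := by
      refine continuous_finsetSum _ fun i _ => ?_
      split_ifs
      · fun_prop
      · unfold excess
        fun_prop
    have hnn : ∀ g, 0 ≤ distSq x (T g) g := fun g => by
      rw [← norm_sq_sub_dualProj x (h0 g)]
      positivity
    have hi : Integrable (fun g => distSq x (T g) g) (stdGaussian (Sig n)) :=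
      hm.integrable_sq.mono' hc.aestronglyMeasurable (Filter.Eventually.of_forall fun g => by
        rw [Real.norm_of_nonneg (hnn g)]
        exact hle g)
    have k1 := le_integral_distSq_level hx hs h0 h1 h2 hi
    have k2 := integral_mono hi hm.integrable_sq hle
    have k3 := variance_stdGaussian_le (lipschitz_fullSup hx)
    rw [variance_eq_sub hm] at k3
    simp only [Pi.pow_apply, NNReal.coe_one, one_pow] at k3
    linarith

lemma integral_fullSup_sub_le {x : Sig n} (hx : ‖x‖ = 1) :
    ∫ g, fullSup x g ∂(stdGaussian (Sig n)) - √(2 / Real.pi)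
      ≤ ∫ g, coneSup l1 x g ∂(stdGaussian (Sig n)) := by
  have hmp := measurePreserving_inner_stdGaussian hx
  have hi : Integrable (fullSup x) (stdGaussian (Sig n)) :=
    (memLp_two_of_lipschitz (lipschitz_fullSup hx)).integrable (by norm_num)
  have ha : Integrable (fun g : Sig n => |⟪x, g⟫|) (stdGaussian (Sig n)) :=
    hmp.integrable_comp_of_integrable integrable_id_gaussianReal.abs
  have he : ∫ g : Sig n, |⟪x, g⟫| ∂(stdGaussian (Sig n)) = √(2 / Real.pi) := by
    rw [← integral_abs_gaussianReal, ← hmp.map_eq, integral_map (by fun_prop)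
      continuous_abs.aestronglyMeasurable]
  rw [← he, ← integral_sub hi ha]
  exact integral_mono (hi.sub ha) (integrable_coneSup l1 x hx) fun g =>
    fullSup_sub_le_coneSup hx g

lemma le_zetaPO {x : Sig n} {s : ℕ} (hx : ‖x‖ = 1) (hs : nnzEntries x = s) {m : ℝ}
    (hm : m = ⨅ τ : ℝ≥0, meanDistSq n s (l1 x) τ) :
    m - √(8 * m / Real.pi) - √(2 * Real.pi * n) / l1 x - (1 - 2 / Real.pi) ≤ zetaPO x l1 := by
  have hL := l1_pos hx
  have hsn := support_le hs
  have hβ : 0 < s - l1 x ^ 2 * (1 - 2 / Real.pi) := by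
    rw [← sum_dualEntry_sq hx hs]; exact sum_dualEntry_sq_pos hx
  obtain ⟨k1, k2⟩ := integral_fullSup_bounds hx hs
  have k3 := integral_fullSup_sub_le hx
  have k4 := integral_coneSup_nonneg hx
  have hm0 : 0 ≤ m := by
    rw [hm]
    exact le_ciInf fun τ => meanDistSq_nonneg hsn hβ.le τ
  rw [← hm] at k1 k2
  rw [zetaPO]
  set a := ∫ g, fullSup x g ∂(stdGaussian (Sig n))
  set z := ∫ g, coneSup l1 x g ∂(stdGaussian (Sig n))
  set c := √(2 / Real.pi) with hc
  set r := √m with hr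
  have hc0 : 0 ≤ c := Real.sqrt_nonneg _
  have hr0 : 0 ≤ r := Real.sqrt_nonneg _
  have hcc : c ^ 2 = 2 / Real.pi := Real.sq_sqrt (by positivity)
  have hrr : r ^ 2 = m := Real.sq_sqrt hm0
  have h8 : √(8 * m / Real.pi) = 2 * (c * r) := by
    rw [show 8 * m / Real.pi = 2 ^ 2 * (2 / Real.pi * m) by ring, Real.sqrt_mul (by positivity),
      Real.sqrt_sq (by norm_num), Real.sqrt_mul (by positivity)]
  have hc1 : c ^ 2 ≤ 1 := by
    rw [hcc]; exact (div_le_one Real.pi_pos).2 Real.two_le_pi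
  have hlarge : 0 ≤ √(2 * Real.pi * n) / l1 x := by positivity
  rw [h8, ← hcc]
  rcases le_or_gt c a with hca | hca
  · have : (a - c) ^ 2 ≤ z ^ 2 := pow_le_pow_left₀ (by linarith) k3 2
    nlinarith [mul_le_mul_of_nonneg_left k1 hc0]
  · -- here the left-hand side is non-positive
    refine le_trans ?_ (sq_nonneg z)
    have k5 := integral_fullSup_nonneg hx
    have ha : a ^ 2 ≤ c ^ 2 := pow_le_pow_left₀ k5 hca.le 2
    rcases le_or_gt c r with hcr | hcr
    · nlinarith [mul_le_mul_of_nonneg_left hcr hc0]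
    · nlinarith [mul_le_mul_of_nonneg_left hcr.le hr0]

/-! ### Monotonicity of the surrogate -/

lemma meanDistSq_le_of_le {s : ℕ} {K L : ℝ} (hK : 0 ≤ K) (h : K ≤ L) (τ : ℝ) :
    meanDistSq n s L τ ≤ meanDistSq n s K τ := by
  have hπ : 0 ≤ 1 - 2 / Real.pi :=
    sub_nonneg.2 ((div_le_one Real.pi_pos).2 Real.two_le_pi)
  have h1 := mul_le_mul_of_nonneg_right (pow_le_pow_left₀ hK h 2) hπ
  have h2 := mul_le_mul_of_nonneg_left h1 (sq_nonneg τ)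
  rw [meanDistSq, meanDistSq]
  nlinarith

lemma meanDistSq_lt_of_lt {s : ℕ} {K L : ℝ} (hK : 0 ≤ K) (h : K < L) {τ : ℝ} (hτ : 0 < τ) :
    meanDistSq n s L τ < meanDistSq n s K τ := by
  have hπ : 0 < 1 - 2 / Real.pi :=
    sub_pos.2 ((div_lt_one Real.pi_pos).2 (by linarith [Real.pi_gt_three]))
  have h1 := mul_lt_mul_of_pos_right (pow_lt_pow_left₀ h hK two_ne_zero) hπ
  have h2 := mul_lt_mul_of_pos_left h1 (pow_pos hτ 2)
  rw [meanDistSq, meanDistSq]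
  nlinarith

lemma zetaHatPO_le_of_l1_le {x y : Sig n} {s : ℕ} (hx : ‖x‖ = 1) (hxs : nnzEntries x = s)
    (hy : ‖y‖ = 1) (hys : nnzEntries y = s) (h : l1 x ≤ l1 y) :
    zetaHatPO y l1 ≤ zetaHatPO x l1 := by
  rw [zetaHatPO_l1_eq hx hxs, zetaHatPO_l1_eq hy hys]
  refine ciInf_mono (bddBelow_meanDistSq (support_le hys) ?_) fun τ =>
    meanDistSq_le_of_le (l1_pos hx).le h τ
  rw [← sum_dualEntry_sq hy hys]
  exact (sum_dualEntry_sq_pos hy).le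

/-- The strictness comes from the optimal level for `x`, which is positive when `s < n`. -/
lemma zetaHatPO_lt_of_l1_lt {x y : Sig n} {s : ℕ} (hx : ‖x‖ = 1) (hxs : nnzEntries x = s)
    (hy : ‖y‖ = 1) (hys : nnzEntries y = s) (hsn : s < n) (h : l1 x < l1 y) :
    zetaHatPO y l1 < zetaHatPO x l1 := by
  have hβ : ∀ z : Sig n, ‖z‖ = 1 → nnzEntries z = s →
      0 < s - l1 z ^ 2 * (1 - 2 / Real.pi) := fun z hz hzs => by
    rw [← sum_dualEntry_sq hz hzs]; exact sum_dualEntry_sq_pos hz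
  obtain ⟨τ, t0, t1, t2, t3⟩ := exists_meanDistSlope_level hsn.le (hβ x hx hxs)
  rw [zetaHatPO_l1_eq hx hxs, zetaHatPO_l1_eq hy hys,
    iInf_meanDistSq_eq hsn.le (hβ x hx hxs).le t0 t1 t2]
  exact (ciInf_le (bddBelow_meanDistSq hsn.le (hβ y hy hys).le) ⟨τ, t0⟩).trans_lt
    (meanDistSq_lt_of_lt (l1_pos hx).le h (t3 hsn))

lemma l1_le_of_equalAmplitude {x y : Sig n} {s : ℕ} (hx : ‖x‖ = 1) (hxs : nnzEntries x = s)
    (hy : ‖y‖ = 1) (hys : nnzEntries y = s) (h : EqualAmplitude y) : l1 x ≤ l1 y := by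
  refine le_of_sq_le_sq ?_ (l1_pos hy).le
  rw [(equalAmplitude_iff hy hys).1 h]
  exact l1_sq_le hx hxs

lemma l1_lt_of_equalAmplitude {x y : Sig n} {s : ℕ} (hx : ‖x‖ = 1) (hxs : nnzEntries x = s)
    (hy : ‖y‖ = 1) (hys : nnzEntries y = s) (h : EqualAmplitude y) (h' : ¬ EqualAmplitude x) :
    l1 x < l1 y := by
  refine (l1_le_of_equalAmplitude hx hxs hy hys h).lt_of_ne fun he => h' ?_
  rw [equalAmplitude_iff hx hxs, he]
  exact (equalAmplitude_iff hy hys).1 h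

end PhaseOnly

/-- Here `x` ranges over the unit vectors of `ℝⁿ` with exactly `s` non-zero entries. -/
theorem theorem3 (n s : ℕ) :
    -- the formula for the surrogate and the two-sided bound for the threshold
    (∀ x : PhaseOnly.Sig n, ‖x‖ = 1 → PhaseOnly.nnzEntries x = s →
      PhaseOnly.zetaHatPO x PhaseOnly.l1
          = n * PhaseOnly.psi ((s : ℝ) / n) (PhaseOnly.l1 x ^ 2 / s) ∧
      n * PhaseOnly.psi ((s : ℝ) / n) (PhaseOnly.l1 x ^ 2 / s)
          - √(8 * (n * PhaseOnly.psi ((s : ℝ) / n) (PhaseOnly.l1 x ^ 2 / s)) / Real.pi)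
          - √(2 * Real.pi * n) / PhaseOnly.l1 x
          - (1 - 2 / Real.pi)
        ≤ PhaseOnly.zetaPO x PhaseOnly.l1 ∧
      PhaseOnly.zetaPO x PhaseOnly.l1
        ≤ n * PhaseOnly.psi ((s : ℝ) / n) (PhaseOnly.l1 x ^ 2 / s)) ∧
    -- the surrogate is decreasing in the `ℓ₁` norm and smallest at equal-amplitude signals
    (∀ x y : PhaseOnly.Sig n, ‖x‖ = 1 → PhaseOnly.nnzEntries x = s →
      ‖y‖ = 1 → PhaseOnly.nnzEntries y = s →
      (PhaseOnly.l1 x ≤ PhaseOnly.l1 y →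
        PhaseOnly.zetaHatPO y PhaseOnly.l1 ≤ PhaseOnly.zetaHatPO x PhaseOnly.l1) ∧
      (s < n → PhaseOnly.l1 x < PhaseOnly.l1 y →
        PhaseOnly.zetaHatPO y PhaseOnly.l1 < PhaseOnly.zetaHatPO x PhaseOnly.l1) ∧
      (PhaseOnly.EqualAmplitude y →
        PhaseOnly.zetaHatPO y PhaseOnly.l1 ≤ PhaseOnly.zetaHatPO x PhaseOnly.l1) ∧
      (s < n → PhaseOnly.EqualAmplitude y → ¬ PhaseOnly.EqualAmplitude x →
        PhaseOnly.zetaHatPO y PhaseOnly.l1 < PhaseOnly.zetaHatPO x PhaseOnly.l1)) := by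
  refine ⟨fun x hx hs => ?_, fun x y hx hxs hy hys => ⟨fun h => ?_, fun hsn h => ?_,
    fun he => ?_, fun hsn he hne => ?_⟩⟩
  · have hψ := PhaseOnly.mul_psi_eq (PhaseOnly.support_pos hx hs) (PhaseOnly.support_le hs)
      (PhaseOnly.l1 x)
    refine ⟨?_, PhaseOnly.le_zetaPO hx hs hψ, ?_⟩
    · rw [hψ]
      exact PhaseOnly.zetaHatPO_l1_eq hx hs
    · rw [hψ]
      exact le_ciInf fun τ => PhaseOnly.zetaPO_le hx hs τ.2
  · exact PhaseOnly.zetaHatPO_le_of_l1_le hx hxs hy hys h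
  · exact PhaseOnly.zetaHatPO_lt_of_l1_lt hx hxs hy hys hsn h
  · exact PhaseOnly.zetaHatPO_le_of_l1_le hx hxs hy hys
      (PhaseOnly.l1_le_of_equalAmplitude hx hxs hy hys he)
  · exact PhaseOnly.zetaHatPO_lt_of_l1_lt hx hxs hy hys hsn
      (PhaseOnly.l1_lt_of_equalAmplitude hx hxs hy hys he hne)
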